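/- An ordered forest on $n$ vertices is a finite disjoint union of rooted plane trees, with a left-to-right order on the trees; its vertices are identified with their left-to-right preorder labels $1,\dots,n$. Operating on a vertex $v$ does nothing if $v$ is a leaf. Otherwise the rightmost child $c$ of $v$ is cut off from $v$ and, together with its descendants, becomes the next child (immediately to the right of $v$) of the parent of $v$; if $v$ is a root, then $c$ becomes the root of a new tree immediately to the right of the tree of $v$. Ordered by reachability under operations ($F' \le F$ if $F'$ arises from $F$ by a finite sequence of operations), the ordered forests on $n$ vertices form the Tamari lattice $\mathrm{Tam}_n$, whose top element $\hat 1$ is the path on $n$ vertices rooted at an endpoint. Let $p \in (0,1)$. Run the Ungarian Markov chain on $\mathrm{Tam}_n$ from $\hat 1$: on each step $t = 1, 2, \dots$ every vertex is selected independently with probability $p$ (also independently of the other steps), and the selected vertices are operated on successively in increasing order of their labels (equivalently, the current forest $F$ is replaced by the meet of $F$ and of the forests obtained from $F$ by operating on a single selected vertex). Let $g_i$ be the first step on which vertex $i$ is selected, let $T_n$ be the number of steps until vertex $1$ is disconnected from every other vertex, and let $E_{[1,n],m}$ be the event that $g_1 = m$ and $g_l < m$ for all $2 \le l \le n$. Theorem.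 There is an absolute constant $C > 4$ such that for every $p \in (0,1)$ and all integers $n \ge 2$ and $m \ge 2$, $$\mathbb{P}\big(T_n \ge f(n) + m - 1 \,\big|\, E_{[1,n],m}\big) \ge \tfrac12,$$ where $$f(x) = \begin{cases} \max\Big(1,\; x\exp\big(-p^8 e^{C/p^2} (\log\log x)^4\big)\Big) & \text{if } x \ge 16, \\ 1 & \text{otherwise.} \end{cases}$$ -/

import Mathlib

open MeasureTheory ProbabilityTheory

/-- An ordered forest on `n` vertices, up to isomorphism of ordered forests. The vertices are
identified with their left-to-right preorder labels (the vertex with label `k + 1` is `k : Fin n`),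
and the forest is recorded by its parent map: `parent v = none` if `v` is a root. Siblings, and
likewise the roots, are ordered from left to right by increasing label.
The last two fields say that the labels are the preorder labels: a parent precedes its children,
and if `v` is a child of `w` then every vertex between `w` and `v` is a descendant of `w`
(its parent exists and is not before `w`). -/
@[ext]
structure OrderedForest (n : ℕ) where
  parent : Fin n → Option (Fin n)
  parent_lt : ∀ v w, parent v = some w → w < v
  preorder : ∀ v w, parent v = some w → ∀ u, w < u → u < v → ∃ x, parent u = some x ∧ w ≤ x

namespace OrderedForest

variable {n : ℕ}

/-- `c` is the rightmost child of `v`. -/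
def IsRightmostChild (F : OrderedForest n) (v c : Fin n) : Prop :=
  F.parent c = some v ∧ ∀ u, F.parent u = some v → u ≤ c

/-- `v` has no children. -/
def IsLeaf (F : OrderedForest n) (v : Fin n) : Prop :=
  ∀ u, F.parent u ≠ some v

open Classical in
/-- The operation on the vertex `v`. If `v` is a leaf, nothing changes. Otherwise the rightmost
child `c` of `v` is cut off from `v` and, together with its descendants, becomes the next child
(immediately to the right of `v`) of the parent of `v`; if `v` is a root, then `c` becomes the root
of a new tree immediately to the right of the tree of `v`. Preorder labels do not change. -/
noncomputable def operate (F : OrderedForest n) (v : Fin n) : OrderedForest n where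
  parent u := if F.IsRightmostChild v u then F.parent v else F.parent u
  parent_lt u w h := by
    split_ifs at h with hu
    · exact (F.parent_lt _ _ h).trans (F.parent_lt _ _ hu.1)
    · exact F.parent_lt _ _ h
  preorder u w h x hwx hxu := by
    by_cases hu : F.IsRightmostChild v u
    · rw [if_pos hu] at h
      have hvu := F.parent_lt _ _ hu.1
      have hwv := F.parent_lt _ _ h
      by_cases hx : F.IsRightmostChild v x
      · rw [if_pos hx]; exact ⟨w, h, le_rfl⟩
      · rw [if_neg hx]
        rcases lt_trichotomy x v with hxv | rfl | hxv
        · exact F.preorder _ _ h x hwx hxv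
        · exact ⟨w, h, le_rfl⟩
        · obtain ⟨y, hy, hvy⟩ := F.preorder _ _ hu.1 x hxv hxu
          exact ⟨y, hy, hwv.le.trans hvy⟩
    · rw [if_neg hu] at h
      obtain ⟨y, hy, hwy⟩ := F.preorder _ _ h x hwx hxu
      by_cases hx : F.IsRightmostChild v x
      · rw [if_pos hx]
        rw [hx.1] at hy
        obtain rfl : v = y := Option.some.inj hy
        rcases hwy.lt_or_eq with hwv | rfl
        · exact F.preorder _ _ h v hwv ((F.parent_lt _ _ hx.1).trans hxu)
        · exact absurd (hx.2 u h) (not_le.2 hxu)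
      · rw [if_neg hx]; exact ⟨y, hy, hwy⟩

/-- The Tamari order on ordered forests: `G ≤ F` if `G` is obtained from `F` by a finite (possibly
empty) sequence of operations on non-leaf vertices. -/
instance : LE (OrderedForest n) where
  le G F := Relation.ReflTransGen (fun A B => ∃ v, ¬ A.IsLeaf v ∧ B = A.operate v) F G

/-- The path `1 - 2 - ⋯ - n` rooted at its first vertex. -/
def path (n : ℕ) : OrderedForest n where
  parent v := if h : v.1 = 0 then none else some ⟨v.1 - 1, by omega⟩
  parent_lt v w h := by
    split_ifs at h with hv
    rw [Option.some.injEq] at h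
    subst h
    rw [Fin.lt_def]; dsimp only; omega
  preorder v w h u hwu huv := by
    split_ifs at h with hv
    rw [Option.some.injEq] at h
    subst h
    rw [Fin.lt_def] at hwu huv
    dsimp only at hwu huv
    omega

/-- The Ungar move on `F` in which exactly the vertices of `S` are selected: they are operated on
successively, in increasing order of their labels. By `isGLB_ungarMove` below, this is the meet of
`F` and of the forests `F.operate v`, `v ∈ S`, in the Tamari order; by `covBy_iff` below, the
`F.operate v` with `v` not a leaf are the forests covered by `F`. -/
noncomputable def ungarMove (F : OrderedForest n) (S : Finset (Fin n)) : OrderedForest n :=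
  (S.sort (· ≤ ·)).foldl operate F

/-- The forest as an undirected graph. -/
def graph (F : OrderedForest n) : SimpleGraph (Fin n) where
  Adj u v := F.parent u = some v ∨ F.parent v = some u
  symm := ⟨fun _ _ h => h.symm⟩
  loopless := ⟨fun v h => (h.elim (F.parent_lt v v) (F.parent_lt v v)).false⟩

/-- `v` is disconnected from every other vertex. -/
def IsIsolated (F : OrderedForest n) (v : Fin n) : Prop :=
  ∀ u, u ≠ v → ¬ F.graph.Reachable v u

/-! The Tamari order is a partial order, its covers are the operations on non-leaf vertices, its
top element is the path, and an Ungar move is a meet. -/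

/-- `k` is `j` or a descendant of `j`. -/
def Desc (F : OrderedForest n) (j k : Fin n) : Prop :=
  j ≤ k ∧ ∀ x, j < x → x ≤ k → ∃ y, F.parent x = some y ∧ j ≤ y

theorem Desc.refl (F : OrderedForest n) (j : Fin n) : F.Desc j j :=
  ⟨le_rfl, fun _ h h' => absurd h (not_lt.2 h')⟩

theorem Desc.mono {F : OrderedForest n} {j k l : Fin n} (h : F.Desc j l) (hjk : j ≤ k)
    (hkl : k ≤ l) : F.Desc j k :=
  ⟨hjk, fun x h1 h2 => h.2 x h1 (h2.trans hkl)⟩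

theorem Desc.trans {F : OrderedForest n} {j k l : Fin n} (h : F.Desc j k) (h' : F.Desc k l) :
    F.Desc j l := by
  refine ⟨h.1.trans h'.1, fun x h1 h2 => ?_⟩
  rcases le_or_gt x k with hx | hx
  · exact h.2 x h1 hx
  · obtain ⟨y, hy, hky⟩ := h'.2 x hx h2
    exact ⟨y, hy, h.1.trans hky⟩

theorem desc_of_parent {F : OrderedForest n} {v w : Fin n} (h : F.parent v = some w) :
    F.Desc w v := by
  refine ⟨(F.parent_lt _ _ h).le, fun x h1 h2 => ?_⟩
  rcases h2.lt_or_eq with h2 | rfl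
  · exact F.preorder _ _ h x h1 h2
  · exact ⟨w, h, le_rfl⟩

theorem parent_iff {F : OrderedForest n} {x y : Fin n} :
    F.parent x = some y ↔ y < x ∧ F.Desc y x ∧ ∀ z, z < x → F.Desc z x → z ≤ y := by
  have key : ∀ y, F.parent x = some y → ∀ z, z < x → F.Desc z x → z ≤ y := by
    intro y h z hz hd
    obtain ⟨w, hw, hzw⟩ := hd.2 x hz le_rfl
    rw [h] at hw
    rwa [Option.some.inj hw]
  refine ⟨fun h => ⟨F.parent_lt _ _ h, desc_of_parent h, key y h⟩, fun ⟨h1, h2, h3⟩ => ?_⟩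
  obtain ⟨w, hw, hyw⟩ := h2.2 x h1 le_rfl
  rw [hw, le_antisymm (h3 w (F.parent_lt _ _ hw) (desc_of_parent hw)) hyw]

theorem ext_desc {F G : OrderedForest n} (h : ∀ j k, F.Desc j k ↔ G.Desc j k) : F = G := by
  have : ∀ x y, F.parent x = some y ↔ G.parent x = some y := by
    intro x y
    rw [parent_iff, parent_iff]
    simp only [h]
  ext x y
  exact this x y

theorem exists_rightmostChild {F : OrderedForest n} {v : Fin n} (h : ¬ F.IsLeaf v) :
    ∃ c, F.IsRightmostChild v c := by
  classical
  unfold IsLeaf at h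
  push Not at h
  obtain ⟨u, hu⟩ := h
  obtain ⟨c, hc, hm⟩ := (Finset.univ.filter fun u => F.parent u = some v).exists_max_image id
    ⟨u, by simpa using hu⟩
  exact ⟨c, by simpa using hc, fun w hw => hm w (by simpa using hw)⟩

theorem operate_of_isLeaf {F : OrderedForest n} {v : Fin n} (h : F.IsLeaf v) :
    F.operate v = F := by
  ext1
  funext u
  exact if_neg fun hu => h u hu.1

theorem parent_operate_eq_some_iff {F : OrderedForest n} {i j x : Fin n} (h : i < j) :
    (F.operate i).parent x = some j ↔ F.parent x = some j := by
  simp only [operate]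
  split_ifs with hx
  · rw [hx.1]
    constructor
    · intro h'; exact absurd (F.parent_lt _ _ h') (not_lt.2 h.le)
    · intro h'; exact absurd (Option.some.inj h') h.ne
  · rfl

/-- The operation on `i` removes the rightmost child of `i` and its descendants from the
descendants of `i`, and changes no other set of descendants. -/
theorem desc_operate {F : OrderedForest n} {i j k : Fin n} :
    (F.operate i).Desc j k ↔ F.Desc j k ∧ (j = i → ∀ c, F.IsRightmostChild i c → k < c) := by
  constructor
  · intro h
    refine ⟨⟨h.1, fun x h1 h2 => ?_⟩, ?_⟩
    · obtain ⟨y, hy, hjy⟩ := h.2 x h1 h2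
      simp only [operate] at hy
      split_ifs at hy with hx
      · exact ⟨i, hx.1, hjy.trans (F.parent_lt _ _ hy).le⟩
      · exact ⟨y, hy, hjy⟩
    · rintro rfl c hc
      by_contra hck
      obtain ⟨y, hy, hjy⟩ := h.2 c (F.parent_lt _ _ hc.1) (not_lt.1 hck)
      simp only [operate, if_pos hc] at hy
      exact absurd (F.parent_lt _ _ hy) (not_lt.2 hjy)
  · rintro ⟨h, h'⟩
    refine ⟨h.1, fun x h1 h2 => ?_⟩
    obtain ⟨y, hy, hjy⟩ := h.2 x h1 h2
    simp only [operate]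
    split_ifs with hx
    · rw [hx.1] at hy
      obtain rfl : i = y := Option.some.inj hy
      rcases hjy.lt_or_eq with hji | rfl
      · exact h.2 i hji ((F.parent_lt _ _ hx.1).le.trans h2)
      · exact absurd (h' rfl x hx) (not_lt.2 h2)
    · exact ⟨y, hy, hjy⟩

theorem desc_of_le {F G : OrderedForest n} (h : G ≤ F) {j k : Fin n} (hd : G.Desc j k) :
    F.Desc j k := by
  have h' : Relation.ReflTransGen (fun A B => ∃ v, ¬ A.IsLeaf v ∧ B = A.operate v) F G := h
  induction h' with
  | refl => exact hd
  | tail h1 h2 ih =>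
    obtain ⟨v, -, rfl⟩ := h2
    exact ih h1 (desc_operate.1 hd).1

theorem le_refl' (F : OrderedForest n) : F ≤ F := Relation.ReflTransGen.refl

theorem operate_le (F : OrderedForest n) (v : Fin n) : F.operate v ≤ F := by
  by_cases h : F.IsLeaf v
  · rw [operate_of_isLeaf h]; exact le_refl' F
  · exact Relation.ReflTransGen.single ⟨v, h, rfl⟩

theorem le_of_desc {F G : OrderedForest n} (h : ∀ j k, G.Desc j k → F.Desc j k) : G ≤ F := by
  classical
  induction hN : (Finset.univ.filter fun q : Fin n × Fin n => F.Desc q.1 q.2).card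
    using Nat.strong_induction_on generalizing F with
  | _ N ih =>
    by_cases hall : ∀ j k, F.Desc j k → G.Desc j k
    · rw [ext_desc fun j k => ⟨h j k, hall j k⟩]; exact le_refl' F
    · push Not at hall
      obtain ⟨i, hi, hmax⟩ := (Finset.univ.filter fun i => ∃ k, F.Desc i k ∧ ¬ G.Desc i k
        ).exists_max_image id (by obtain ⟨j, k, h1, h2⟩ := hall; exact ⟨j, by simpa using ⟨k, h1, h2⟩⟩)
      simp only [Finset.mem_filter, Finset.mem_univ, true_and, id] at hi hmax
      obtain ⟨k, hk, hk'⟩ := hi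
      have hik : i < k := lt_of_le_of_ne hk.1 (by rintro rfl; exact hk' (Desc.refl G i))
      have hleaf : ¬ F.IsLeaf i := by
        intro hl
        have hlt : i.1 + 1 < n := by have := k.2; rw [Fin.lt_def] at hik; omega
        obtain ⟨y, hy, hiy⟩ := hk.2 ⟨i.1 + 1, hlt⟩ (by rw [Fin.lt_def]; simp)
          (by rw [Fin.le_def]; rw [Fin.lt_def] at hik; simpa using hik)
        have h1 := F.parent_lt _ _ hy
        obtain rfl : y = i := by
          rw [Fin.lt_def] at h1; rw [Fin.le_def] at hiy; dsimp only at h1; ext; omega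
        exact hl _ hy
      obtain ⟨c, hc⟩ := exists_rightmostChild hleaf
      have hic := F.parent_lt _ _ hc.1
      have hsub : ∀ j l, G.Desc j l → (F.operate i).Desc j l := by
        intro j l hjl
        refine desc_operate.2 ⟨h j l hjl, ?_⟩
        rintro rfl c' hc'
        obtain rfl : c = c' := le_antisymm (hc'.2 _ hc.1) (hc.2 _ hc'.1)
        by_contra hcl
        have hjc : G.Desc j c := hjl.mono hic.le (not_lt.1 hcl)
        rcases lt_or_ge k c with hkc | hck
        · exact hk' (hjc.mono hk.1 hkc.le)
        · have hFck : F.Desc c k := by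
            refine ⟨hck, fun x h1 h2 => ?_⟩
            obtain ⟨y, hy, hjy⟩ := hk.2 x (hic.trans h1) h2
            refine ⟨y, hy, ?_⟩
            by_contra hyc
            rcases hjy.lt_or_eq with hjy | rfl
            · obtain ⟨z, hz, hyz⟩ := F.preorder _ _ hy c (not_le.1 hyc) h1
              rw [hc.1] at hz
              exact absurd (Option.some.inj hz) (hjy.trans_le hyz).ne
            · exact absurd (hc.2 x hy) (not_le.2 h1)
          have hGck : G.Desc c k := by
            by_contra hn
            exact absurd (hmax c ⟨k, hFck, hn⟩) (not_le.2 hic)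
          exact hk' (hjc.trans hGck)
      have hcard : (Finset.univ.filter fun q : Fin n × Fin n => (F.operate i).Desc q.1 q.2).card
          < N := by
        rw [← hN]
        apply Finset.card_lt_card
        rw [Finset.ssubset_iff_of_subset (by
          intro q hq
          simp only [Finset.mem_filter, Finset.mem_univ, true_and] at hq ⊢
          exact (desc_operate.1 hq).1)]
        refine ⟨(i, c), by simpa using desc_of_parent hc.1, ?_⟩
        simp only [Finset.mem_filter, Finset.mem_univ, true_and]
        exact fun hd => ((desc_operate.1 hd).2 rfl c hc).false
      exact Relation.ReflTransGen.head ⟨i, hleaf, rfl⟩ (ih _ hcard hsub rfl)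

theorem le_iff_desc {F G : OrderedForest n} : G ≤ F ↔ ∀ j k, G.Desc j k → F.Desc j k :=
  ⟨fun h _ _ => desc_of_le h, le_of_desc⟩

instance : PartialOrder (OrderedForest n) where
  le_refl := le_refl'
  le_trans _ _ _ h h' := Relation.ReflTransGen.trans h' h
  le_antisymm _ _ h h' := ext_desc fun _ _ => ⟨desc_of_le h, desc_of_le h'⟩

theorem isTop_path (n : ℕ) : IsTop (path n) := by
  intro F
  refine le_of_desc fun j k h => ⟨h.1, fun x h1 _ => ?_⟩
  rw [Fin.lt_def] at h1
  refine ⟨⟨x.1 - 1, by omega⟩, dif_neg (by omega), ?_⟩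
  rw [Fin.le_def]; dsimp only; omega

theorem desc_foldl_operate (l : List (Fin n)) (hl : l.Pairwise (· < ·)) (F : OrderedForest n)
    (j k : Fin n) :
    (l.foldl operate F).Desc j k ↔
      F.Desc j k ∧ (j ∈ l → ∀ c, F.IsRightmostChild j c → k < c) := by
  induction l generalizing F with
  | nil => simp
  | cons i l ih =>
    rw [List.pairwise_cons] at hl
    rw [List.foldl_cons, ih hl.2, desc_operate, List.mem_cons]
    have hr : j ∈ l → ∀ c, (F.operate i).IsRightmostChild j c ↔ F.IsRightmostChild j c := by
      intro hj c
      simp only [IsRightmostChild, parent_operate_eq_some_iff (hl.1 j hj)]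
    constructor
    · rintro ⟨⟨h1, h2⟩, h3⟩
      refine ⟨h1, ?_⟩
      rintro (rfl | hj)
      · exact h2 rfl
      · exact fun c hc => h3 hj c ((hr hj c).2 hc)
    · rintro ⟨h1, h2⟩
      refine ⟨⟨h1, ?_⟩, fun hj c hc => h2 (Or.inr hj) c ((hr hj c).1 hc)⟩
      rintro rfl
      exact h2 (Or.inl rfl)

theorem isGLB_ungarMove (F : OrderedForest n) (S : Finset (Fin n)) :
    IsGLB (insert F (F.operate '' (S : Set (Fin n)))) (F.ungarMove S) := by
  have hM : ∀ j k, (F.ungarMove S).Desc j k ↔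
      F.Desc j k ∧ (j ∈ S → ∀ c, F.IsRightmostChild j c → k < c) := by
    intro j k
    rw [ungarMove, desc_foldl_operate _ (Finset.sortedLT_sort S).pairwise, Finset.mem_sort]
  constructor
  · rintro G (rfl | ⟨i, hi, rfl⟩)
    · exact le_of_desc fun j k h => ((hM j k).1 h).1
    · refine le_of_desc fun j k h => desc_operate.2 ⟨((hM j k).1 h).1, ?_⟩
      rintro rfl
      exact ((hM j k).1 h).2 hi
  · intro G hG
    refine le_of_desc fun j k h => (hM j k).2
      ⟨desc_of_le (hG (Set.mem_insert _ _)) h, fun hj => ?_⟩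
    have := desc_of_le (hG (Set.mem_insert_of_mem _ ⟨j, hj, rfl⟩)) h
    exact (desc_operate.1 this).2 rfl

theorem covBy_iff {F G : OrderedForest n} : G ⋖ F ↔ ∃ v, ¬ F.IsLeaf v ∧ G = F.operate v := by
  have hlt : ∀ {A B : OrderedForest n}, A < B → ∃ v, ¬ B.IsLeaf v ∧ A ≤ B.operate v := by
    intro A B h
    have h' : Relation.ReflTransGen (fun A B => ∃ v, ¬ A.IsLeaf v ∧ B = A.operate v) B A := h.le
    rcases Relation.ReflTransGen.cases_head h' with h0 | ⟨C, ⟨v, hv, rfl⟩, hC⟩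
    · exact absurd h0 h.ne'
    · exact ⟨v, hv, hC⟩
  have hop : ∀ {A : OrderedForest n} {v : Fin n}, ¬ A.IsLeaf v → A.operate v < A := by
    intro A v hv
    refine lt_of_le_of_ne (operate_le A v) fun h => ?_
    obtain ⟨c, hc⟩ := exists_rightmostChild hv
    have hd := desc_of_parent hc.1
    rw [← h] at hd
    exact ((desc_operate.1 hd).2 rfl c hc).false
  constructor
  · intro h
    obtain ⟨v, hv, hle⟩ := hlt h.lt
    exact ⟨v, hv, (h.eq_or_eq hle (operate_le F v)).resolve_right (hop hv).ne |>.symm⟩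
  · rintro ⟨v, hv, rfl⟩
    refine ⟨hop hv, fun G h1 h2 => ?_⟩
    obtain ⟨w, hw, hle⟩ := hlt h2
    obtain ⟨c, hc⟩ := exists_rightmostChild hw
    by_cases hvw : w = v
    · subst hvw; exact (h1.trans_le hle).false
    · have hd : (F.operate v).Desc w c :=
        desc_operate.2 ⟨desc_of_parent hc.1, fun h => absurd h hvw⟩
      exact ((desc_operate.1 (desc_of_le (h1.le.trans hle) hd)).2 rfl c hc).false

end OrderedForest

/-- The law of i.i.d. Bernoulli variables `ω (t, v)`, `t : ℕ`, `v : Fin n`, of parameter `p`, where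
`ω (t, v) = true` means that the vertex `v` is selected (receives an operation) on step `t + 1`.
So the steps `1, 2, 3, …` have the indices `0, 1, 2, …`. -/
noncomputable def selectionLaw (n : ℕ) (p : unitInterval) : Measure (ℕ × Fin n → Bool) :=
  Measure.infinitePi fun _ => bernoulliMeasure true false p

/-- The Ungarian Markov chain on the Tamari lattice, started at its top element, driven by the
selections `ω`: the forest after `t` steps. -/
noncomputable def ungarianChain {n : ℕ} (ω : ℕ × Fin n → Bool) : ℕ → OrderedForest n
  | 0 => OrderedForest.path n
  | t + 1 => (ungarianChain ω t).ungarMove (Finset.univ.filter fun v => ω (t, v) = true)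

/-- `g_v`: the first step (in `{1, 2, …}`) on which the vertex `v` receives an operation, `⊤` if
there is none. -/
noncomputable def firstOperation {n : ℕ} (v : Fin n) (ω : ℕ × Fin n → Bool) : ℕ∞ :=
  ⨅ (t : ℕ) (_ : ω (t, v) = true), ((t + 1 : ℕ) : ℕ∞)

/-- The event `E_{[i, j], m}` that `g_i = m` and `g_l < m` for all `l ∈ [i + 1, j]`. -/
def firstOperationEvent {n : ℕ} (i j : Fin n) (m : ℕ) : Set (ℕ × Fin n → Bool) :=
  {ω | firstOperation i ω = m ∧ ∀ l, i < l → l ≤ j → firstOperation l ω < m}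

/-- The number of steps until the vertex `v` is disconnected from every other vertex, `⊤` if this
never happens. -/
noncomputable def isolationTime {n : ℕ} (v : Fin n) (ω : ℕ × Fin n → Bool) : ℕ∞ :=
  ⨅ (t : ℕ) (_ : (ungarianChain ω t).IsIsolated v), (t : ℕ∞)

open Classical in
/-- The function `f`, with its parameters `C` and `p`. -/
noncomputable def lowerRate (C p x : ℝ) : ℝ :=
  if 16 ≤ x then
    max 1 (x * Real.exp (-(p ^ 8 * Real.exp (C / p ^ 2) * Real.log (Real.log x) ^ 4)))
  else 1

/-!
Write `r_v` for the last descendant of the vertex `v`. An operation on `v` moves `r_v` to just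
before the smallest `c > v` with `r_c = r_v`, and vertex `1` (the root) is isolated when `r` of the
root has travelled from the right end to the label of the root. The question is how often the root
skips many labels at once, which happens when it cuts off a vertex `v` that still has descendants.

**A skip needs a catch-up.** Since the sets of descendants are laminar, the root stops at each
former value of `r_v` before it can cut off `v` together with other descendants of `v`. So at a skip
over `v` the root has received, since it arrived at the block of `v`, at least as many operations as
`v` has received since its own first operation (`numOps_le_numOps_of_cut`).

**Boundaries.** On the event `E_{[1, n], m}` every other vertex is operated on before step `m`, when
the root starts. If `w` is a left-to-right maximum (record) of the times of first operation, then
after step `m - 1` no vertex strictly between the root and `w` has `w` as a descendant, so the root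
has to stop just before `w` (`IsRecord.isBoundary`). Hence it loses at least one step per boundary,
and if it arrives at a boundary with a delay `τ` after step `m`, then on the way to the next one
only the `M` vertices right after that next boundary matter: if the root catches up with none of
them, it has to cut them off one at a time, which takes `M` steps (`ArrivesAfter.add`). By
Hoeffding's inequality and a union bound over these `M` vertices only, with `M ≤ τ ^ (3 / 2)`, a
catch-up has probability at most `M ^ 2 exp (-c p ^ 2 τ ^ (1 / 2))` (`selectionLaw_catchUp_le`).
The operations after step `m` are independent of the records, so the boundaries may be random.

**Counting boundaries.** With `D` boundaries to build up a delay `D`, of the order of `log log n`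
times a power of `1 / p`, and `D` more along which the delay is raised to the power `3 / 2` at
(nearly) each one, the delay reaches any `N ≤ n` (`le_delaySeq_two_mul`). The boundaries are found
in windows `[s, A s)` that increase geometrically: by exchangeability the latest first operations
among the labels `1, …, A s` are confined to the first `s` labels with probability at most `1 / A`
(`selectionLaw_latestIn_le`). With `2 D + 1` windows and `A` proportional to `D`, all this fits into
`n` vertices when `N` is about `n exp (-O(D ^ 2))`, which exceeds `f(n)`, and the failure
probabilities of the windows and of the catch-ups are at most `1 / 4` each.
-/

/-! ### Last descendants and how an Ungar move changes them -/

namespace OrderedForest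

variable {n : ℕ}

open Classical in
/-- The largest label of a descendant of `v`: the descendants of `v`, including `v`, are the
vertices with labels from `v` to `F.lastDesc v`. The value is a natural number because it is
compared with predecessors of labels. -/
noncomputable def lastDesc (F : OrderedForest n) (v : Fin n) : ℕ :=
  ((Finset.univ.filter fun k => F.Desc v k).max' ⟨v, by simpa using Desc.refl F v⟩ : Fin n)

theorem desc_iff_le_lastDesc {F : OrderedForest n} {v k : Fin n} :
    F.Desc v k ↔ v ≤ k ∧ k.1 ≤ F.lastDesc v := by
  classical
  have hne : (Finset.univ.filter fun k => F.Desc v k).Nonempty := ⟨v, by simpa using Desc.refl F v⟩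
  constructor
  · intro h
    refine ⟨h.1, ?_⟩
    have := Finset.le_max' (Finset.univ.filter fun k => F.Desc v k) k (by simpa using h)
    exact this
  · rintro ⟨h1, h2⟩
    have := Finset.max'_mem _ hne
    rw [Finset.mem_filter] at this
    exact this.2.mono h1 (by rw [Fin.le_def]; exact h2)

theorem exists_desc_val_eq_lastDesc (F : OrderedForest n) (v : Fin n) :
    ∃ k, F.Desc v k ∧ k.1 = F.lastDesc v := by
  classical
  have hne : (Finset.univ.filter fun k => F.Desc v k).Nonempty := ⟨v, by simpa using Desc.refl F v⟩
  have := Finset.max'_mem _ hne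
  rw [Finset.mem_filter] at this
  exact ⟨_, this.2, rfl⟩

theorem lastDesc_lt (F : OrderedForest n) (v : Fin n) : F.lastDesc v < n := by
  obtain ⟨k, -, hk⟩ := F.exists_desc_val_eq_lastDesc v
  omega

theorem le_lastDesc (F : OrderedForest n) (v : Fin n) : v.1 ≤ F.lastDesc v :=
  (desc_iff_le_lastDesc.1 (Desc.refl F v)).2

theorem lastDesc_le_iff {F : OrderedForest n} {v : Fin n} {x : ℕ} :
    F.lastDesc v ≤ x ↔ ∀ k, F.Desc v k → k.1 ≤ x := by
  constructor
  · intro h k hk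
    exact (desc_iff_le_lastDesc.1 hk).2.trans h
  · intro h
    obtain ⟨k, hk, he⟩ := F.exists_desc_val_eq_lastDesc v
    exact he ▸ h k hk

/-- The sets of descendants form a laminar family. -/
theorem lastDesc_le_lastDesc {F : OrderedForest n} {v u : Fin n} (h : v ≤ u)
    (h' : u.1 ≤ F.lastDesc v) : F.lastDesc u ≤ F.lastDesc v :=
  lastDesc_le_iff.2 fun _ hk =>
    (desc_iff_le_lastDesc.1 ((desc_iff_le_lastDesc.2 ⟨h, h'⟩).trans hk)).2

/-- The rightmost child of `v` is the smallest vertex after `v` with the same last descendant. -/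
theorem IsRightmostChild.lastDesc_eq {F : OrderedForest n} {v c : Fin n}
    (hc : F.IsRightmostChild v c) :
    v < c ∧ F.lastDesc c = F.lastDesc v ∧ ∀ u, v < u → u < c → F.lastDesc u < c := by
  have hvc := F.parent_lt _ _ hc.1
  have hd := desc_of_parent hc.1
  refine ⟨hvc, le_antisymm (lastDesc_le_lastDesc hvc.le (desc_iff_le_lastDesc.1 hd).2) ?_, ?_⟩
  · obtain ⟨k, hk, he⟩ := F.exists_desc_val_eq_lastDesc v
    have hck : c ≤ k := by
      have := (desc_iff_le_lastDesc.1 hd).2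
      rw [Fin.le_def]; omega
    have : F.Desc c k := by
      refine ⟨hck, fun x h1 h2 => ?_⟩
      obtain ⟨y, hy, hvy⟩ := hk.2 x (hvc.trans h1) h2
      refine ⟨y, hy, ?_⟩
      by_contra hyc
      rcases hvy.lt_or_eq with hvy | rfl
      · obtain ⟨z, hz, hyz⟩ := F.preorder _ _ hy c (not_le.1 hyc) h1
        rw [hc.1] at hz
        exact absurd (Option.some.inj hz) (hvy.trans_le hyz).ne
      · exact absurd (hc.2 x hy) (not_le.2 h1)
    rw [← he]
    exact (desc_iff_le_lastDesc.1 this).2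
  · intro u hvu huc
    by_contra hcon
    have hd' : F.Desc u c := desc_iff_le_lastDesc.2 ⟨huc.le, not_lt.1 hcon⟩
    obtain ⟨y, hy, huy⟩ := hd'.2 c huc le_rfl
    rw [hc.1] at hy
    exact absurd (Option.some.inj hy) (hvu.trans_le huy).ne

theorem desc_ungarMove {F : OrderedForest n} {S : Finset (Fin n)} {j k : Fin n} :
    (F.ungarMove S).Desc j k ↔
      F.Desc j k ∧ (j ∈ S → ∀ c, F.IsRightmostChild j c → k < c) := by
  rw [ungarMove, desc_foldl_operate _ (Finset.sortedLT_sort S).pairwise, Finset.mem_sort]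

theorem lastDesc_ungarMove_le (F : OrderedForest n) (S : Finset (Fin n)) (v : Fin n) :
    (F.ungarMove S).lastDesc v ≤ F.lastDesc v :=
  lastDesc_le_iff.2 fun _ hk => (desc_iff_le_lastDesc.1 (desc_ungarMove.1 hk).1).2

theorem lastDesc_ungarMove_of_notMem {F : OrderedForest n} {S : Finset (Fin n)} {v : Fin n}
    (h : v ∉ S) : (F.ungarMove S).lastDesc v = F.lastDesc v := by
  refine le_antisymm (lastDesc_ungarMove_le F S v) (lastDesc_le_iff.2 fun k hk => ?_)
  exact (desc_iff_le_lastDesc.1 (desc_ungarMove.2 ⟨hk, fun h' => absurd h' h⟩)).2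

theorem lastDesc_ungarMove_of_mem {F : OrderedForest n} {S : Finset (Fin n)} {v : Fin n}
    (h : v ∈ S) (hv : v.1 < F.lastDesc v) :
    ∃ c : Fin n, v < c ∧ F.lastDesc c = F.lastDesc v ∧ (∀ u, v < u → u < c → F.lastDesc u < c) ∧
      (F.ungarMove S).lastDesc v = c.1 - 1 := by
  have hleaf : ¬ F.IsLeaf v := by
    intro hl
    obtain ⟨k, hk, he⟩ := F.exists_desc_val_eq_lastDesc v
    have hlt : v.1 + 1 < n := by have := k.2; omega
    obtain ⟨y, hy, hvy⟩ := hk.2 ⟨v.1 + 1, hlt⟩ (by rw [Fin.lt_def]; simp)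
      (by rw [Fin.le_def]; simp only; omega)
    have h1 := F.parent_lt _ _ hy
    obtain rfl : y = v := by
      rw [Fin.lt_def] at h1; rw [Fin.le_def] at hvy; dsimp only at h1; ext; omega
    exact hl _ hy
  obtain ⟨c, hc⟩ := exists_rightmostChild hleaf
  obtain ⟨h1, h2, h3⟩ := hc.lastDesc_eq
  refine ⟨c, h1, h2, h3, le_antisymm (lastDesc_le_iff.2 fun k hk => ?_) ?_⟩
  · have := (desc_ungarMove.1 hk).2 h c hc
    rw [Fin.lt_def] at this; omega
  · have hcn : c.1 - 1 < n := by omega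
    have hvc : v.1 < c.1 := h1
    have hcl := (desc_iff_le_lastDesc.1 (desc_of_parent hc.1)).2
    have : (F.ungarMove S).Desc v ⟨c.1 - 1, hcn⟩ := by
      refine desc_ungarMove.2 ⟨desc_iff_le_lastDesc.2 ⟨by rw [Fin.le_def]; simp only; omega,
        by simp only; omega⟩, fun _ c' hc' => ?_⟩
      obtain rfl : c = c' := le_antisymm (hc'.2 _ hc.1) (hc.2 _ hc'.1)
      rw [Fin.lt_def]; simp only; omega
    exact (desc_iff_le_lastDesc.1 this).2

theorem lastDesc_path (v : Fin n) : (path n).lastDesc v = n - 1 := by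
  have hv := v.2
  refine le_antisymm (by have := (path n).lastDesc_lt v; omega) ?_
  have : (path n).Desc v ⟨n - 1, by omega⟩ := by
    refine ⟨by rw [Fin.le_def]; simp only; omega, fun x h1 _ => ?_⟩
    rw [Fin.lt_def] at h1
    refine ⟨⟨x.1 - 1, by omega⟩, dif_neg (by omega), ?_⟩
    rw [Fin.le_def]; dsimp only; omega
  exact (desc_iff_le_lastDesc.1 this).2

theorem IsIsolated.lastDesc_eq_zero {F : OrderedForest n} {o : Fin n} (ho : o.1 = 0)
    (h : F.IsIsolated o) : F.lastDesc o = 0 := by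
  by_contra hne
  obtain ⟨k, hk, he⟩ := F.exists_desc_val_eq_lastDesc o
  have hlt : 1 < n := by have := k.2; omega
  obtain ⟨y, hy, -⟩ := hk.2 ⟨1, hlt⟩ (by rw [Fin.lt_def]; simp [ho])
    (by rw [Fin.le_def]; simp only; omega)
  have h1 := F.parent_lt _ _ hy
  obtain rfl : y = o := by
    rw [Fin.lt_def] at h1; dsimp only at h1; ext; omega
  refine h ⟨1, hlt⟩ (by intro h'; rw [Fin.ext_iff] at h'; simp only at h'; omega)
    (SimpleGraph.Adj.reachable ?_)
  exact Or.inr hy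

end OrderedForest

/-! ### Passage of the root through the labels -/

section Dynamics

variable {n : ℕ} {ω : ℕ × Fin n → Bool}

/-- The last descendant of `v` in the forest after `t` steps. -/
noncomputable def reach (ω : ℕ × Fin n → Bool) (t : ℕ) (v : Fin n) : ℕ :=
  (ungarianChain ω t).lastDesc v

/-- The number of operations on `v` on the steps `a + 1, …, b`, which have the indices
`a, …, b - 1`. -/
def numOps (ω : ℕ × Fin n → Bool) (v : Fin n) (a b : ℕ) : ℕ :=
  ((Finset.Ico a b).filter fun t => ω (t, v) = true).card

theorem reach_zero (ω : ℕ × Fin n → Bool) (v : Fin n) : reach ω 0 v = n - 1 :=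
  OrderedForest.lastDesc_path v

theorem val_le_reach (t : ℕ) (v : Fin n) : v.1 ≤ reach ω t v := OrderedForest.le_lastDesc _ v

theorem reach_le_reach {t : ℕ} {v u : Fin n} (h : v ≤ u) (h' : u.1 ≤ reach ω t v) :
    reach ω t u ≤ reach ω t v :=
  OrderedForest.lastDesc_le_lastDesc h h'

theorem reach_antitone (ω : ℕ × Fin n → Bool) (v : Fin n) : Antitone fun t => reach ω t v :=
  antitone_nat_of_succ_le fun _ => OrderedForest.lastDesc_ungarMove_le _ _ v

theorem reach_succ_of_false {t : ℕ} {v : Fin n} (h : ω (t, v) = false) :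
    reach ω (t + 1) v = reach ω t v :=
  OrderedForest.lastDesc_ungarMove_of_notMem (by simp [h])

/-- An operation on a vertex `v` which is not a leaf moves its last descendant to just before the
smallest vertex after `v` with the same last descendant. -/
theorem exists_reach_succ {t : ℕ} {v : Fin n} (h : ω (t, v) = true) (hv : v.1 < reach ω t v) :
    ∃ c : Fin n, v < c ∧ reach ω t c = reach ω t v ∧
      (∀ u, v < u → u < c → reach ω t u < c) ∧ reach ω (t + 1) v = c.1 - 1 :=
  OrderedForest.lastDesc_ungarMove_of_mem (by simpa using h) hv

theorem reach_succ_lt {t : ℕ} {v : Fin n} (h : ω (t, v) = true) (hv : v.1 < reach ω t v) :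
    reach ω (t + 1) v < reach ω t v := by
  obtain ⟨c, h1, h2, -, h4⟩ := exists_reach_succ h hv
  have := val_le_reach (ω := ω) t c
  rw [Fin.lt_def] at h1
  omega

theorem reach_eq_of_forall_false {t : ℕ} {v : Fin n} (h : ∀ s < t, ω (s, v) = false) :
    reach ω t v = n - 1 := by
  induction t with
  | zero => exact reach_zero ω v
  | succ t ih => rw [reach_succ_of_false (h t (by omega)), ih fun s hs => h s (by omega)]

/-- Suppose the root `o` cuts off the vertex `v` while `v` still has other descendants. Then since
any time `σ` at which the root had not yet got past the last descendant that `v` had at time `a`,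
the root has received at least as many operations as `v` has received between `a` and the cut.
Indeed it has to stop at every former last descendant of `v`. -/
theorem numOps_le_numOps_of_cut {o v : Fin n} (ho : o.1 = 0) {a σ t : ℕ}
    (hσt : σ ≤ t) (hσ : reach ω a v ≤ reach ω σ o) (hv : 0 < v.1) (hvt : v.1 < reach ω t v)
    (hcut : reach ω t v = reach ω t o) :
    numOps ω v a t ≤ numOps ω o σ t := by
  have hdec : ∀ s s', s < s' → s' ≤ t → ω (s, v) = true → reach ω s' v < reach ω s v := by
    intro s s' hs hs' h
    have h1 : reach ω t v ≤ reach ω s v := reach_antitone ω v (by omega)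
    have h2 : reach ω s' v ≤ reach ω (s + 1) v := reach_antitone ω v hs
    have := reach_succ_lt h (hvt.trans_le h1)
    omega
  -- The number of former last descendants of `v` that the root has got past after `s` steps.
  let κ : ℕ → ℕ := fun s =>
    ((Finset.Ico a t).filter fun i => ω (i, v) = true ∧ reach ω s o < reach ω i v).card
  have hstep : ∀ s, σ ≤ s → s < t → κ (s + 1) ≤ κ s + if ω (s, o) = true then 1 else 0 := by
    intro s hσs hst
    split_ifs with hop
    · have hz : reach ω t o ≤ reach ω s o := reach_antitone ω o hst.le
      obtain ⟨c, hc1, hc2, hc3, hc4⟩ := exists_reach_succ hop (by omega)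
      rw [Fin.lt_def] at hc1
      have hone : ((Finset.Ico a t).filter fun i =>
          ω (i, v) = true ∧ reach ω i v = reach ω s o).card ≤ 1 := by
        rw [Finset.card_le_one]
        intro i hi j hj
        simp only [Finset.mem_filter, Finset.mem_Ico] at hi hj
        rcases lt_trichotomy i j with h | h | h
        · have := hdec i j h (by omega) hi.2.1; omega
        · exact h
        · have := hdec j i h (by omega) hj.2.1; omega
      refine le_trans (Finset.card_le_card ?_) ((Finset.card_union_le _ _).trans
        (Nat.add_le_add_left hone _))
      intro i hi
      simp only [Finset.mem_filter, Finset.mem_Ico, Finset.mem_union] at hi ⊢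
      obtain ⟨hi1, hi2, hi3⟩ := hi
      rcases lt_trichotomy (reach ω s o) (reach ω i v) with h | h | h
      · exact Or.inl ⟨hi1, hi2, h⟩
      · exact Or.inr ⟨hi1, hi2, h.symm⟩
      -- A last descendant of `v` strictly between `c` and the position of the root is impossible.
      · exfalso
        have hvc : v.1 < c.1 := by
          have h1 : reach ω t o ≤ reach ω (s + 1) o := reach_antitone ω o hst
          omega
        rcases le_or_gt i s with his | his
        · have h1 := reach_le_reach (ω := ω) (t := i) (v := v) (u := c) hvc.le (by omega)
          have h2 : reach ω s c ≤ reach ω i c := reach_antitone ω c his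
          omega
        · have h1 : reach ω i v ≤ reach ω s v := reach_antitone ω v his.le
          have h2 := hc3 v (by rw [Fin.lt_def]; omega) hvc
          omega
    · rw [Bool.not_eq_true] at hop
      simp only [κ, reach_succ_of_false hop]
      omega
  have hκ : ∀ s, σ ≤ s → s ≤ t → κ s ≤ numOps ω o σ s := by
    intro s hs
    induction s, hs using Nat.le_induction with
    | base =>
      intro _
      have : κ σ = 0 := by
        simp only [κ, Finset.card_eq_zero, Finset.filter_eq_empty_iff, Finset.mem_Ico]
        rintro i hi ⟨-, h⟩
        have : reach ω i v ≤ reach ω a v := reach_antitone ω v hi.1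
        omega
      omega
    | succ s hs ih =>
      intro hst
      have h1 := hstep s hs (by omega)
      have h2 := ih (by omega)
      have h3 : numOps ω o σ (s + 1) = numOps ω o σ s + if ω (s, o) = true then 1 else 0 := by
        unfold numOps
        rw [← Finset.insert_Ico_right_eq_Ico_add_one hs, Finset.filter_insert]
        split_ifs with h
        · rw [Finset.card_insert_of_notMem (by simp)]
        · rfl
      omega
  refine le_trans (Finset.card_le_card fun i hi => ?_) (hκ t hσt le_rfl)
  simp only [Finset.mem_filter, Finset.mem_Ico] at hi ⊢
  exact ⟨hi.1, hi.2, hcut ▸ hdec i t hi.1.2 le_rfl hi.2⟩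

/-- After `a` steps, no vertex with a label from `1` to `y` has a descendant beyond `y`. -/
def IsBoundary (ω : ℕ × Fin n → Bool) (a y : ℕ) : Prop :=
  ∀ u : Fin n, 0 < u.1 → u.1 ≤ y → reach ω a u ≤ y

/-- The last descendant of the root `o` is at most `y` only after at least `σ` steps. -/
def ArrivesAfter (ω : ℕ × Fin n → Bool) (o : Fin n) (y σ : ℕ) : Prop :=
  ∀ s, reach ω s o ≤ y → σ ≤ s

theorem IsBoundary.le_reach_succ {o : Fin n} (ho : o.1 = 0) {a y s : ℕ} (hy : IsBoundary ω a y)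
    (has : a ≤ s) (h : y < reach ω s o) : y ≤ reach ω (s + 1) o := by
  rcases hop : ω (s, o) with _ | _
  · rw [reach_succ_of_false hop]; exact h.le
  · obtain ⟨c, hc1, hc2, -, hc4⟩ := exists_reach_succ hop (by omega)
    rw [Fin.lt_def] at hc1
    by_contra hcon
    have h1 := hy c (by omega) (by omega)
    have h2 : reach ω s c ≤ reach ω a c := reach_antitone ω c has
    omega

theorem ArrivesAfter.le_reach {o : Fin n} (ho : o.1 = 0) {a y σ : ℕ} (hy : IsBoundary ω a y)
    (haσ : a < σ) (h : ArrivesAfter ω o y σ) : y ≤ reach ω σ o := by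
  obtain ⟨s, rfl⟩ : ∃ s, σ = s + 1 := ⟨σ - 1, by omega⟩
  refine hy.le_reach_succ ho (by omega) ?_
  by_contra hcon
  have := h s (by omega)
  omega

theorem ArrivesAfter.succ {o : Fin n} (ho : o.1 = 0) {a y y' σ : ℕ} (hy : IsBoundary ω a y)
    (haσ : a < σ) (h : ArrivesAfter ω o y σ) (hlt : y' < y) : ArrivesAfter ω o y' (σ + 1) := by
  intro s hs
  have h1 := h s (by omega)
  rcases h1.lt_or_eq with h1 | rfl
  · exact h1
  · have := h.le_reach ho hy haσ; omega

/-- If on the way between two boundaries the operations on the root do not catch up with those on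
the `M` vertices after the left boundary, then the root has to cut off these vertices one by one,
and this takes `M` steps. -/
theorem ArrivesAfter.add {o : Fin n} (ho : o.1 = 0) {a b y y' σ M : ℕ} (hy : IsBoundary ω a y)
    (hy' : IsBoundary ω a y') (hab : a ≤ b) (haσ : a < σ) (hM : y' + M ≤ y)
    (h : ArrivesAfter ω o y σ)
    (hops : ∀ k < M, ∀ v : Fin n, y' < v.1 → v.1 ≤ y' + M →
      numOps ω o σ (σ + k) < numOps ω v b (σ + k)) :
    ArrivesAfter ω o y' (σ + M) := by
  have hσ := h.le_reach ho hy haσ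
  have key : ∀ k, k ≤ M → y' + M ≤ reach ω (σ + k) o + k := by
    intro k
    induction k with
    | zero => intro _; simp only [add_zero]; omega
    | succ k ih =>
      intro hk
      have ih := ih (by omega)
      rcases hop : ω (σ + k, o) with _ | _
      · rw [← add_assoc σ k 1, reach_succ_of_false hop]; omega
      · obtain ⟨c, hc1, hc2, -, hc4⟩ := exists_reach_succ hop (by omega)
        rw [Fin.lt_def] at hc1
        rw [← add_assoc σ k 1, hc4]
        have hyc : y' < c.1 := by
          by_contra hcon
          have h1 := hy' c (by omega) (by omega)
          have h2 : reach ω (σ + k) c ≤ reach ω a c := reach_antitone ω c (by omega)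
          omega
        by_cases hcM : c.1 ≤ y' + M
        · have hcl := val_le_reach (ω := ω) (σ + k) c
          by_cases heq : c.1 = reach ω (σ + k) c
          · omega
          · exfalso
            have h1 : reach ω b c ≤ reach ω a c := reach_antitone ω c hab
            have h2 := hy c (by omega) (by omega)
            have := numOps_le_numOps_of_cut (ω := ω) (o := o) (v := c) ho (a := b) (σ := σ)
              (t := σ + k) (by omega) (by omega) (by omega) (by omega) hc2
            have := hops k (by omega) c hyc hcM
            omega
        · omega
  intro s hs
  by_contra hcon
  have hs' : reach ω (σ + M) o ≤ reach ω s o := reach_antitone ω o (by omega)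
  have h1 : σ ≤ s := h s (by omega)
  have := key (s - σ) (by omega)
  rw [show σ + (s - σ) = s by omega] at this
  omega

end Dynamics

/-! ### Events that depend on finitely many selections -/

section Events

variable {n : ℕ} {p : unitInterval}

instance (n : ℕ) (p : unitInterval) : IsProbabilityMeasure (selectionLaw n p) := by
  unfold selectionLaw; infer_instance

theorem eq_preimage_restrict_of_dependsOn {ι : Type*} {S : Set (ι → Bool)} {I : Finset ι}
    (h : DependsOn (fun ω => ω ∈ S) (I : Set ι)) : S = I.restrict ⁻¹' (I.restrict '' S) := by
  refine (Set.subset_preimage_image _ _).antisymm ?_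
  rintro ω ⟨ω', h1, h2⟩
  have : (ω' ∈ S) = (ω ∈ S) := h fun i hi => congrFun h2 ⟨i, hi⟩
  exact this ▸ h1

theorem measurableSet_image_restrict {ι : Type*} {S : Set (ι → Bool)} {I : Finset ι} :
    MeasurableSet (I.restrict '' S : Set (I → Bool)) :=
  (Set.toFinite _).measurableSet

theorem measurableSet_of_dependsOn {ι : Type*} {S : Set (ι → Bool)} {I : Finset ι}
    (h : DependsOn (fun ω => ω ∈ S) (I : Set ι)) : MeasurableSet S := by
  rw [eq_preimage_restrict_of_dependsOn h]
  exact measurableSet_image_restrict.preimage (Finset.measurable_restrict I)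

theorem iIndepFun_eval_selectionLaw (n : ℕ) (p : unitInterval) :
    iIndepFun (fun i (ω : ℕ × Fin n → Bool) => ω i) (selectionLaw n p) :=
  iIndepFun_infinitePi (X := fun _ x => x) fun _ => measurable_id

theorem selectionLaw_inter_of_dependsOn {S T : Set (ℕ × Fin n → Bool)} {I J : Finset (ℕ × Fin n)}
    (hS : DependsOn (fun ω => ω ∈ S) (I : Set (ℕ × Fin n)))
    (hT : DependsOn (fun ω => ω ∈ T) (J : Set (ℕ × Fin n))) (hIJ : Disjoint I J) :
    selectionLaw n p (S ∩ T) = selectionLaw n p S * selectionLaw n p T := by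
  have h := (iIndepFun_eval_selectionLaw n p).indepFun_finset I J hIJ fun i => measurable_pi_apply i
  have := h.measure_inter_preimage_eq_mul _ _ (measurableSet_image_restrict (S := S))
    (measurableSet_image_restrict (S := T))
  have e : ∀ K : Finset (ℕ × Fin n), (fun (ω : ℕ × Fin n → Bool) (i : K) => ω i) = K.restrict :=
    fun _ => rfl
  rwa [e, e, ← eq_preimage_restrict_of_dependsOn hS, ← eq_preimage_restrict_of_dependsOn hT] at this

/-- A union bound for events which are indexed by a random variable and independent of it. -/
theorem selectionLaw_inter_random_le {E : Set (ℕ × Fin n → Bool)} {Y : (ℕ × Fin n → Bool) → ℕ}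
    {bad : ℕ → Set (ℕ × Fin n → Bool)} {I J : Finset (ℕ × Fin n)}
    (hY : ∀ k, DependsOn (fun ω => ω ∈ E ∩ {ω | Y ω = k}) (I : Set (ℕ × Fin n)))
    (hbad : ∀ k, DependsOn (fun ω => ω ∈ bad k) (J : Set (ℕ × Fin n))) (hIJ : Disjoint I J)
    {δ : ENNReal} (hδ : ∀ k, selectionLaw n p (bad k) ≤ δ) :
    selectionLaw n p (E ∩ {ω | ω ∈ bad (Y ω)}) ≤ δ * selectionLaw n p E := by
  have hE : E = ⋃ k, E ∩ {ω | Y ω = k} := by ext ω; simp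
  calc selectionLaw n p (E ∩ {ω | ω ∈ bad (Y ω)})
      ≤ selectionLaw n p (⋃ k, (E ∩ {ω | Y ω = k}) ∩ bad k) := by
        refine measure_mono ?_
        rintro ω ⟨h1, h2⟩
        exact Set.mem_iUnion.2 ⟨Y ω, ⟨h1, rfl⟩, h2⟩
    _ ≤ ∑' k, selectionLaw n p ((E ∩ {ω | Y ω = k}) ∩ bad k) := measure_iUnion_le _
    _ ≤ ∑' k, δ * selectionLaw n p (E ∩ {ω | Y ω = k}) := by
        refine ENNReal.tsum_le_tsum fun k => ?_
        rw [selectionLaw_inter_of_dependsOn (hY k) (hbad k) hIJ, mul_comm]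
        gcongr
        exact hδ k
    _ = δ * selectionLaw n p E := by
        rw [ENNReal.tsum_mul_left]
        conv_rhs => rw [hE]
        rw [measure_iUnion _ fun k => measurableSet_of_dependsOn (hY k)]
        intro i j hij
        refine Set.disjoint_left.2 ?_
        rintro ω ⟨-, h1⟩ ⟨-, h2⟩
        exact hij (h1.symm.trans h2)

theorem dependsOn_numOps_le {o v : Fin n} {a b c d : ℕ} :
    DependsOn (fun ω => numOps ω v a b ≤ numOps ω o c d)
      ((Finset.Ico (min a c) (max b d) ×ˢ Finset.univ : Finset (ℕ × Fin n)) : Set (ℕ × Fin n)) := by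
  intro ω ω' h
  have h1 : ∀ (u : Fin n) (a' b' : ℕ), min a c ≤ a' → b' ≤ max b d →
      numOps ω u a' b' = numOps ω' u a' b' := by
    intro u a' b' ha hb
    unfold numOps
    congr 1
    refine Finset.filter_congr fun t ht => ?_
    rw [Finset.mem_Ico] at ht
    rw [h (t, u) (by
      rw [Finset.mem_coe, Finset.mem_product, Finset.mem_Ico]
      exact ⟨⟨by omega, by omega⟩, Finset.mem_univ _⟩)]
  simp only
  rw [h1 v a b (by omega) (by omega), h1 o c d (by omega) (by omega)]

theorem hasSubgaussianMGF_indicator_sub (i : ℕ × Fin n) :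
    HasSubgaussianMGF (fun ω : ℕ × Fin n → Bool => (if ω i = true then (1 : ℝ) else 0) - p)
      (1 / 4) (selectionLaw n p) := by
  have hm : Measurable fun ω : ℕ × Fin n → Bool => (if ω i = true then (1 : ℝ) else 0) :=
    (measurable_of_countable fun b : Bool => if b = true then (1 : ℝ) else 0).comp
      (measurable_pi_apply i)
  have h := hasSubgaussianMGF_of_mem_Icc (μ := selectionLaw n p) (a := 0) (b := 1) hm.aemeasurable
    (Filter.Eventually.of_forall fun ω => by split_ifs <;> simp)
  have hint : ∫ ω, (if ω i = true then (1 : ℝ) else 0) ∂(selectionLaw n p) = p := by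
    rw [← integral_map (φ := fun ω : ℕ × Fin n → Bool => ω i)
      (f := fun b : Bool => if b = true then (1 : ℝ) else 0) (measurable_pi_apply i).aemeasurable
      (measurable_of_countable _).aestronglyMeasurable, selectionLaw, Measure.infinitePi_map_eval,
      integral_bernoulliMeasure]
    simp
  rw [hint] at h
  convert! h using 1
  norm_num

/-- With a head start of `τ` steps, the operations on `v` are unlikely to be caught up with by
those on `o`. -/
theorem selectionLaw_numOps_le {o v : Fin n} (hov : v ≠ o) (b τ k : ℕ) :
    selectionLaw n p {ω | numOps ω v b (b + τ + k) ≤ numOps ω o (b + τ) (b + τ + k)} ≤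
      ENNReal.ofReal (Real.exp (-(2 * (p : ℝ) ^ 2 * τ ^ 2 / (τ + 2 * k)))) := by
  classical
  let X : ℕ × Fin n → (ℕ × Fin n → Bool) → ℝ := fun i ω => (if ω i = true then (1 : ℝ) else 0) - p
  let Z : ℕ × Fin n → (ℕ × Fin n → Bool) → ℝ := fun i ω => (if i.2 = o then 1 else -1) * X i ω
  let S := Finset.Ico (b + τ) (b + τ + k) ×ˢ {o}
  let T := Finset.Ico b (b + τ + k) ×ˢ {v}
  have hST : Disjoint S T := by
    rw [Finset.disjoint_left]
    intro i hi hj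
    simp only [S, T, Finset.mem_product, Finset.mem_singleton] at hi hj
    exact hov (hj.2.symm.trans hi.2)
  have hZ : iIndepFun Z (selectionLaw n p) :=
    (iIndepFun_eval_selectionLaw n p).comp
      (fun i x => (if i.2 = o then 1 else -1) * ((if x = true then (1 : ℝ) else 0) - p))
      fun i => measurable_of_countable _
  have hsub : ∀ i ∈ S ∪ T, HasSubgaussianMGF (Z i) (1 / 4) (selectionLaw n p) := by
    intro i _
    have h := hasSubgaussianMGF_indicator_sub (p := p) i
    by_cases hi : i.2 = o
    · exact h.congr (Filter.Eventually.of_forall fun ω => by simp [Z, X, hi])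
    · exact h.neg.congr (Filter.Eventually.of_forall fun ω => by simp [Z, X, hi])
  have hop : ∀ (u : Fin n) (a c : ℕ) (ω : ℕ × Fin n → Bool), a ≤ c →
      ∑ t ∈ Finset.Ico a c, X (t, u) ω = numOps ω u a c - p * (c - a : ℝ) := by
    intro u a c ω hac
    simp only [X, Finset.sum_sub_distrib, Finset.sum_boole, Finset.sum_const, Nat.card_Ico, numOps,
      nsmul_eq_mul, Nat.cast_sub hac]
    ring
  have hsum : ∀ ω, ∑ i ∈ S ∪ T, Z i ω =
      numOps ω o (b + τ) (b + τ + k) - numOps ω v b (b + τ + k) + p * τ := by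
    intro ω
    rw [Finset.sum_union hST, Finset.sum_product, Finset.sum_product]
    simp only [Z, Finset.sum_singleton, if_true, if_neg hov, one_mul, neg_mul,
      Finset.sum_neg_distrib]
    rw [hop o _ _ ω (by omega), hop v _ _ ω (by omega)]
    push_cast
    ring
  have hp : (0 : ℝ) ≤ p := p.2.1
  have h := HasSubgaussianMGF.measure_sum_ge_le_of_iIndepFun hZ hsub
    (ε := p * τ) (by positivity)
  have hcard : (S ∪ T).card = τ + 2 * k := by
    rw [Finset.card_union_of_disjoint hST, Finset.card_product, Finset.card_product,
      Finset.card_singleton, Finset.card_singleton, Nat.card_Ico, Nat.card_Ico]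
    omega
  have hset : {ω | numOps ω v b (b + τ + k) ≤ numOps ω o (b + τ) (b + τ + k)} =
      {ω | (p : ℝ) * τ ≤ ∑ i ∈ S ∪ T, Z i ω} := by
    ext ω
    simp only [Set.mem_ofPred_eq, hsum]
    rw [← Nat.cast_le (α := ℝ)]
    constructor <;> intro h <;> linarith
  rw [hset, ← ofReal_measureReal (by finiteness)]
  refine ENNReal.ofReal_le_ofReal (h.trans_eq ?_)
  rw [Finset.sum_const, hcard]
  congr 1
  push_cast
  rw [nsmul_eq_mul]
  push_cast
  rcases eq_or_ne ((τ : ℝ) + 2 * k) 0 with h0 | h0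
  · rw [h0]; simp
  · field_simp
    ring

end Events

/-! ### First operations and left-to-right maxima -/

section FirstOperation

variable {n : ℕ} {p : unitInterval} {ω ω' : ℕ × Fin n → Bool}

theorem firstOperation_eq {v : Fin n} {t : ℕ} (h : ω (t, v) = true)
    (h' : ∀ s < t, ω (s, v) = false) : firstOperation v ω = (t + 1 : ℕ) := by
  refine le_antisymm (iInf₂_le t h) (le_iInf₂ fun s hs => ?_)
  rw [Nat.cast_le]
  by_contra hcon
  rw [h' s (by omega)] at hs
  exact absurd hs (by simp)

theorem exists_firstOperation_eq {v : Fin n} (h : firstOperation v ω < ⊤) :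
    ∃ t : ℕ, firstOperation v ω = (t + 1 : ℕ) ∧ ω (t, v) = true ∧ ∀ s < t, ω (s, v) = false := by
  have hex : ∃ t, ω (t, v) = true := by
    by_contra hcon
    push Not at hcon
    refine h.ne ?_
    unfold firstOperation
    simp [hcon]
  have h1 := Nat.find_spec hex
  have h2 : ∀ s < Nat.find hex, ω (s, v) = false := fun s hs => by
    simpa using Nat.find_min hex hs
  exact ⟨Nat.find hex, firstOperation_eq h1 h2, h1, h2⟩

theorem eq_false_of_lt_firstOperation {v : Fin n} {t : ℕ}
    (h : ((t + 1 : ℕ) : ℕ∞) < firstOperation v ω) : ω (t, v) = false := by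
  by_contra hcon
  rw [Bool.not_eq_false] at hcon
  exact absurd (iInf₂_le t hcon) (not_le.2 h)

theorem firstOperation_congr {v : Fin n} {m : ℕ} (h : ∀ t < m, ω (t, v) = ω' (t, v))
    (hm : firstOperation v ω ≤ m) : firstOperation v ω' = firstOperation v ω := by
  obtain ⟨t, h1, h2, h3⟩ := exists_firstOperation_eq (hm.trans_lt (ENat.natCast_lt_top m))
  rw [h1, Nat.cast_le] at hm
  rw [h1]
  exact firstOperation_eq (h t (by omega) ▸ h2) fun s hs => h s (by omega) ▸ h3 s hs

/-- The selections on the first `m` steps. -/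
def firstRows (n m : ℕ) : Finset (ℕ × Fin n) := Finset.range m ×ˢ Finset.univ

theorem firstOperationEvent.le {o l : Fin n} (ho : o.1 = 0) (hl : l.1 = n - 1) {m : ℕ}
    (h : ω ∈ firstOperationEvent o l m) (v : Fin n) : firstOperation v ω ≤ m := by
  by_cases hv : v = o
  · rw [hv]; exact h.1.le
  · refine (h.2 v ?_ ?_).le
    · rw [Fin.lt_def]; rw [Fin.ext_iff] at hv; omega
    · rw [Fin.le_def]; omega

/-- On the event `E_{[1, n], m}`, the first operations are determined by the first `m` steps. -/
theorem dependsOn_of_firstOperation {o l : Fin n} (ho : o.1 = 0) (hl : l.1 = n - 1) {m : ℕ}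
    (Q : (Fin n → ℕ∞) → Prop) :
    DependsOn (fun ω => ω ∈ firstOperationEvent o l m ∩
      {ω | Q fun v => firstOperation v ω}) (firstRows n m : Set (ℕ × Fin n)) := by
  have key : ∀ ω ω' : ℕ × Fin n → Bool, (∀ i ∈ (firstRows n m : Set (ℕ × Fin n)), ω i = ω' i) →
      ω ∈ firstOperationEvent o l m ∩ {ω | Q fun v => firstOperation v ω} →
      ω' ∈ firstOperationEvent o l m ∩ {ω | Q fun v => firstOperation v ω} := by
    rintro ω ω' h ⟨h1, h2⟩
    have : ∀ v, firstOperation v ω' = firstOperation v ω := fun v =>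
      firstOperation_congr (fun t ht => h (t, v) (by simp [firstRows, ht]))
        (firstOperationEvent.le ho hl h1 v)
    simpa only [firstOperationEvent, Set.mem_inter_iff, Set.mem_ofPred_eq, this]
      using And.intro h1 h2
  exact fun ω ω' h => propext ⟨key ω ω' h, key ω' ω fun i hi => (h i hi).symm⟩

theorem dependsOn_firstOperationEvent {o l : Fin n} (ho : o.1 = 0) (hl : l.1 = n - 1) {m : ℕ} :
    DependsOn (fun ω => ω ∈ firstOperationEvent o l m) (firstRows n m : Set (ℕ × Fin n)) := by
  simpa using dependsOn_of_firstOperation ho hl (m := m) fun _ => True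

/-- The vertex `w` is not the first vertex, and no vertex between the first one and `w` receives
its first operation later than `w`. -/
def IsRecord (ω : ℕ × Fin n → Bool) (w : Fin n) : Prop :=
  0 < w.1 ∧ ∀ u : Fin n, 0 < u.1 → u ≤ w → firstOperation u ω ≤ firstOperation w ω

/-- At its first operation, a vertex on the left of a record `w` loses `w` and everything beyond. -/
theorem IsRecord.isBoundary {o l : Fin n} (ho : o.1 = 0) (hl : l.1 = n - 1) {m : ℕ}
    (h : ω ∈ firstOperationEvent o l m) {w : Fin n} (hw : IsRecord ω w) :
    IsBoundary ω (m - 1) (w.1 - 1) := by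
  intro u hu huw
  have hw0 := hw.1
  have hum : firstOperation u ω < m :=
    h.2 u (by rw [Fin.lt_def]; omega) (by rw [Fin.le_def]; omega)
  obtain ⟨t, h1, h2, h3⟩ := exists_firstOperation_eq (hum.trans (ENat.natCast_lt_top m))
  rw [h1, Nat.cast_lt] at hum
  have hru := reach_eq_of_forall_false h3
  have hwt : ((t + 1 : ℕ) : ℕ∞) ≤ firstOperation w ω :=
    h1 ▸ hw.2 u hu (by rw [Fin.le_def]; omega)
  have hrw := reach_eq_of_forall_false (ω := ω) (t := t) (v := w) fun s hs =>
    eq_false_of_lt_firstOperation (lt_of_lt_of_le (by rw [Nat.cast_lt]; omega) hwt)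
  obtain ⟨c, hc1, hc2, hc3, hc4⟩ := exists_reach_succ h2 (by omega)
  have hcw : c ≤ w := by
    by_contra hcon
    rw [not_le] at hcon
    have := hc3 w (by rw [Fin.lt_def]; omega) hcon
    omega
  have h4 : reach ω (m - 1) u ≤ reach ω (t + 1) u := reach_antitone ω u (by omega)
  rw [Fin.le_def] at hcw
  omega

theorem firstOperationEvent.arrivesAfter {o l : Fin n} {m : ℕ}
    (h : ω ∈ firstOperationEvent o l m) {y : ℕ} (hy : y < n - 1) : ArrivesAfter ω o y m := by
  intro s hs
  by_contra hcon
  have := reach_eq_of_forall_false (ω := ω) (t := s) (v := o) fun i hi =>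
    eq_false_of_lt_firstOperation (by rw [h.1, Nat.cast_lt]; omega)
  omega

/-- Among the vertices with labels from `1` to `N`, the latest first operations all occur at labels
in `(a, b]`. -/
def LatestIn (g : Fin n → ℕ∞) (N a b : ℕ) : Prop :=
  ∃ l : Fin n, a < l.1 ∧ l.1 ≤ b ∧
    ∀ l' : Fin n, 0 < l'.1 → l'.1 ≤ N → (l'.1 ≤ a ∨ b < l'.1) → g l' < g l

theorem exists_isRecord {N s : ℕ} (hs : s < N) (hN : N < n)
    (h : ¬ LatestIn (fun v => firstOperation v ω) N 0 s) :
    ∃ w : Fin n, s < w.1 ∧ w.1 ≤ N ∧ IsRecord ω w := by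
  classical
  obtain ⟨w, hw, hmax⟩ := (Finset.univ.filter fun v : Fin n => s < v.1 ∧ v.1 ≤ N).exists_max_image
    (fun v => firstOperation v ω) ⟨⟨s + 1, by omega⟩, by simp; omega⟩
  simp only [Finset.mem_filter, Finset.mem_univ, true_and] at hw hmax
  refine ⟨w, hw.1, hw.2, by omega, fun u hu huw => ?_⟩
  rw [Fin.le_def] at huw
  by_cases hus : s < u.1
  · exact hmax u ⟨hus, by omega⟩
  · unfold LatestIn at h
    push Not at h
    obtain ⟨l', h1, h2, h3, h4⟩ := h u hu (by omega)
    exact h4.trans (hmax l' ⟨h3.resolve_left (by omega), h2⟩)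

/-! ### Exchangeability of the first operations -/

/-- Relabelling the vertices by a permutation. -/
def relabel (π : Equiv.Perm (Fin n)) (ω : ℕ × Fin n → Bool) : ℕ × Fin n → Bool :=
  fun i => ω (i.1, π i.2)

theorem measurePreserving_relabel (π : Equiv.Perm (Fin n)) :
    MeasurePreserving (relabel π) (selectionLaw n p) (selectionLaw n p) := by
  refine ⟨measurable_pi_lambda _ fun i => measurable_pi_apply _, ?_⟩
  have hf : Function.Injective fun i : ℕ × Fin n => (i.1, π i.2) := by
    rintro ⟨a, b⟩ ⟨a', b'⟩ h
    simpa using h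
  exact Measure.map_infinitePi_infinitePi_of_inj
    (P := fun _ : ℕ × Fin n => bernoulliMeasure true false p) hf

/-- The map which exchanges the labels in `(0, s]` with those in `(b, b + s]`. -/
def blockSwapFun (s b : ℕ) (hb : b + s < n) (v : Fin n) : Fin n :=
  if h : 0 < v.1 ∧ v.1 ≤ s then ⟨v.1 + b, by omega⟩
  else if b < v.1 ∧ v.1 ≤ b + s then ⟨v.1 - b, by omega⟩ else v

theorem val_blockSwapFun (s b : ℕ) (hb : b + s < n) (v : Fin n) :
    (blockSwapFun s b hb v).1 = if 0 < v.1 ∧ v.1 ≤ s then v.1 + b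
      else if b < v.1 ∧ v.1 ≤ b + s then v.1 - b else v.1 := by
  unfold blockSwapFun
  split_ifs <;> rfl

theorem involutive_blockSwapFun (s b : ℕ) (hs : s ≤ b) (hb : b + s < n) :
    Function.Involutive (blockSwapFun s b hb) := by
  intro v
  ext
  rw [val_blockSwapFun, val_blockSwapFun]
  split_ifs <;> omega

theorem selectionLaw_latestIn_eq {o l : Fin n} (ho : o.1 = 0) (hl : l.1 = n - 1) {m N s b : ℕ}
    (hs : s ≤ b) (hb : b + s ≤ N) (hN : N < n) :
    selectionLaw n p (firstOperationEvent o l m ∩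
        {ω | LatestIn (fun v => firstOperation v ω) N 0 s}) =
      selectionLaw n p (firstOperationEvent o l m ∩
        {ω | LatestIn (fun v => firstOperation v ω) N b (b + s)}) := by
  have hinv := involutive_blockSwapFun (n := n) s b hs (by omega)
  set π := hinv.toPerm with hπ
  have hmeas := measurableSet_of_dependsOn (dependsOn_of_firstOperation ho hl (m := m)
    fun g => LatestIn g N b (b + s))
  rw [← (measurePreserving_relabel π).measure_preimage hmeas.nullMeasurableSet]
  congr 1
  have hval : ∀ v, (π v).1 = if 0 < v.1 ∧ v.1 ≤ s then v.1 + b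
      else if b < v.1 ∧ v.1 ≤ b + s then v.1 - b else v.1 :=
    val_blockSwapFun s b (by omega)
  replace hinv : ∀ v, π (π v) = v := hinv
  have hg : ∀ (v : Fin n) (ω : ℕ × Fin n → Bool),
      firstOperation v (relabel π ω) = firstOperation (π v) ω := fun _ _ => rfl
  ext ω
  simp only [Set.mem_inter_iff, Set.mem_preimage, Set.mem_ofPred_eq, hg, firstOperationEvent]
  have ho' : π o = o := by
    ext; rw [hval, if_neg (by omega), if_neg (by omega)]
  rw [ho']
  refine and_congr (and_congr_right fun _ => ⟨fun h v hv _ => ?_, fun h v hv _ => ?_⟩)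
    ⟨?_, ?_⟩
  · refine h (π v) ?_ ?_
    · rw [Fin.lt_def] at hv ⊢; rw [hval]; split_ifs <;> omega
    · rw [Fin.le_def]; omega
  · have := h (π v) ?_ ?_
    · rwa [hinv] at this
    · rw [Fin.lt_def] at hv ⊢; rw [hval]; split_ifs <;> omega
    · rw [Fin.le_def]; omega
  · rintro ⟨v, h1, h2, h3⟩
    refine ⟨π v, ?_, ?_, fun v' h4 h5 h6 => ?_⟩
    · rw [hval]; split_ifs <;> omega
    · rw [hval]; split_ifs <;> omega
    · change firstOperation (π v') ω < firstOperation (π (π v)) ω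
      rw [hinv]
      refine h3 (π v') ?_ ?_ ?_ <;> rw [hval] <;> split_ifs <;> omega
  · rintro ⟨v, h1, h2, h3⟩
    refine ⟨π v, ?_, ?_, fun v' h4 h5 h6 => ?_⟩
    · rw [hval]; split_ifs <;> omega
    · rw [hval]; split_ifs <;> omega
    · have h7 := h3 (π v') ?_ ?_ ?_
      · change firstOperation (π (π v')) ω < firstOperation (π v) ω at h7
        rwa [hinv] at h7
      all_goals rw [hval]; split_ifs <;> omega

/-- With conditional probability at least `1 - 1 / A`, there is a record in `(s, A s]`: the latest
first operations in `(0, A s]` are equally likely to be confined to each of its `A` blocks of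
length `s`. -/
theorem selectionLaw_latestIn_le {o l : Fin n} (ho : o.1 = 0) (hl : l.1 = n - 1) {m A s : ℕ}
    (hA : 0 < A) (hN : A * s < n) :
    selectionLaw n p (firstOperationEvent o l m ∩
        {ω | LatestIn (fun v => firstOperation v ω) (A * s) 0 s}) ≤
      (A : ENNReal)⁻¹ * selectionLaw n p (firstOperationEvent o l m) := by
  let F : ℕ → Set (ℕ × Fin n → Bool) := fun b => firstOperationEvent o l m ∩
    {ω | LatestIn (fun v => firstOperation v ω) (A * s) (b * s) (b * s + s)}
  have hF : ∀ b < A, selectionLaw n p (F 0) = selectionLaw n p (F b) := by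
    intro b hb
    rcases Nat.eq_zero_or_pos b with rfl | hb0
    · rfl
    · have := selectionLaw_latestIn_eq (p := p) ho hl (m := m) (N := A * s) (s := s) (b := b * s)
        (Nat.le_mul_of_pos_left s hb0)
        (by calc b * s + s = (b + 1) * s := by ring
              _ ≤ A * s := Nat.mul_le_mul_right s hb) hN
      simpa [F] using this
  have hdisj : (Finset.range A : Set ℕ).PairwiseDisjoint F := by
    have key : ∀ b c ω, b < c → c < A → ω ∈ F b → ω ∈ F c → False := by
      rintro b c ω hbc hc ⟨-, v, h1, h2, h3⟩ ⟨-, w, h4, h5, h6⟩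
      have hbs : b * s + s ≤ c * s := by
        calc b * s + s = (b + 1) * s := by ring
          _ ≤ c * s := Nat.mul_le_mul_right s hbc
      have hcs : c * s + s ≤ A * s := by
        calc c * s + s = (c + 1) * s := by ring
          _ ≤ A * s := Nat.mul_le_mul_right s hc
      exact lt_asymm (h3 w (by omega) (by omega) (Or.inr (by omega)))
        (h6 v (by omega) (by omega) (Or.inl (by omega)))
    intro b hb c hc hbc
    rw [Finset.mem_coe, Finset.mem_range] at hb hc
    refine Set.disjoint_left.2 fun ω h1 h2 => ?_
    rcases lt_or_gt_of_ne hbc with h | h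
    · exact key b c ω h hc h1 h2
    · exact key c b ω h hb h2 h1
  have hsum : (A : ENNReal) * selectionLaw n p (F 0) ≤
      selectionLaw n p (firstOperationEvent o l m) := by
    calc (A : ENNReal) * selectionLaw n p (F 0)
        = ∑ b ∈ Finset.range A, selectionLaw n p (F b) := by
          rw [Finset.sum_congr rfl fun b hb => (hF b (Finset.mem_range.1 hb)).symm]
          simp
      _ = selectionLaw n p (⋃ b ∈ Finset.range A, F b) :=
          (measure_biUnion_finset hdisj fun b _ => measurableSet_of_dependsOn
            (dependsOn_of_firstOperation ho hl fun g => LatestIn g (A * s) (b * s) (b * s + s))).symm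
      _ ≤ _ := measure_mono (Set.iUnion₂_subset fun b _ => Set.inter_subset_left)
  have hF0 : F 0 = firstOperationEvent o l m ∩
      {ω | LatestIn (fun v => firstOperation v ω) (A * s) 0 s} := by simp [F]
  rw [← hF0, ← ENNReal.div_eq_inv_mul]
  rw [ENNReal.le_div_iff_mul_le (Or.inl (by simpa using hA.ne')) (Or.inl (by simp)), mul_comm]
  exact hsum

theorem selectionLaw_firstOperationEvent_ne_zero (o l : Fin n) {m : ℕ} (hm : 2 ≤ m) (hp0 : 0 < p) (hp1 : p < 1) :
    selectionLaw n p (firstOperationEvent o l m) ≠ 0 := by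
  classical
  let ψ : ℕ × Fin n → Bool := fun i => if i.2 = o then decide (i.1 + 1 = m) else true
  let t : ℕ × Fin n → Set Bool := fun i => {ψ i}
  have hsub : (firstRows n m : Set (ℕ × Fin n)).pi t ⊆ firstOperationEvent o l m := by
    intro ω hω
    have h : ∀ s v, s < m → ω (s, v) = ψ (s, v) := fun s v hs => hω (s, v) (by simp [firstRows, hs])
    refine ⟨?_, fun v hv _ => ?_⟩
    · rw [firstOperation_eq (t := m - 1), Nat.sub_add_cancel (by omega)]
      · rw [h _ _ (by omega)]; simp [ψ]; omega
      · intro s hs; rw [h _ _ (by omega)]; simp [ψ]; omega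
    · rw [firstOperation_eq (t := 0) _ (by simp)]
      · rw [Nat.cast_lt]; omega
      · rw [h _ _ (by omega)]; simp [ψ, hv.ne']
  refine fun h0 => absurd (measure_mono_null hsub h0) ?_
  rw [selectionLaw, Measure.infinitePi_pi _ fun i _ => measurableSet_singleton _]
  refine Finset.prod_ne_zero_iff.2 fun i _ => ?_
  have hp0' : unitInterval.toNNReal p ≠ 0 := by
    intro h
    rw [← NNReal.coe_eq_zero] at h
    exact hp0.ne' (Subtype.ext h)
  have hp1' : unitInterval.toNNReal (unitInterval.symm p) ≠ 0 := by
    intro h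
    rw [← NNReal.coe_eq_zero] at h
    refine hp1.ne (Subtype.ext ?_)
    have : 1 - (p : ℝ) = 0 := h
    simp only [Set.Icc.coe_one]; linarith
  rw [bernoulliMeasure_apply p (measurableSet_singleton _)]
  rcases ψ i <;> simp [hp0', hp1']

end FirstOperation

/-! ### The root between successive boundaries -/

section Chain

variable {n : ℕ} {p : unitInterval} {ω : ℕ × Fin n → Bool}

theorem ArrivesAfter.mono {o : Fin n} {y y' σ σ' : ℕ} (h : ArrivesAfter ω o y σ) (hy : y' ≤ y)
    (hσ : σ' ≤ σ) : ArrivesAfter ω o y' σ' :=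
  fun s hs => hσ.trans (h s (hs.trans hy))

/-- Travelling along the boundaries `y 0 > y 1 > ⋯` at mutual distances at least `N`, the root
arrives at `y i` with a delay of at least `seq i`, unless this exceeds `N`. -/
theorem ArrivesAfter.chain {o : Fin n} (ho : o.1 = 0) {m J N : ℕ} {y seq : ℕ → ℕ} (hm : 1 ≤ m)
    (hN : 0 < N) (h0 : ArrivesAfter ω o (y 0) m) (hb : ∀ i < J, IsBoundary ω (m - 1) (y i))
    (hy : ∀ i, i + 1 < J → y (i + 1) + N ≤ y i) (hseq : seq 0 = 0)
    (hstep : ∀ i, i + 1 < J → seq (i + 1) = seq i + 1 ∨ (seq i < N →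
      ∀ k < min N (seq (i + 1)), ∀ v : Fin n, y (i + 1) < v.1 →
        v.1 ≤ y (i + 1) + min N (seq (i + 1)) →
          numOps ω o (m + seq i) (m + seq i + k) < numOps ω v m (m + seq i + k))) :
    ∀ i < J, ArrivesAfter ω o (y i) (m + min N (seq i)) := by
  intro i
  induction i with
  | zero => intro _; exact h0.mono le_rfl (by omega)
  | succ i ih =>
    intro hi
    have ih := ih (by omega)
    have hyi := hy i hi
    rcases hstep i hi with h | h
    · refine (ih.succ ho (hb i (by omega)) (by omega) (y' := y (i + 1)) (by omega)).mono le_rfl ?_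
      omega
    · by_cases hlt : seq i < N
      · rw [min_eq_right hlt.le] at ih
        exact (ih.add ho (b := m) (M := min N (seq (i + 1))) (hb i (by omega)) (hb (i + 1) hi)
          (by omega) (by omega) (by omega) (h hlt)).mono le_rfl (by omega)
      · exact ih.mono (by omega) (by omega)

/-- The event that within `M` steps after step `m + τ` the root `o` receives at least as many
operations as one of the `M` vertices after the boundary `y` receives from step `m` on. -/
def catchUp (o : Fin n) (m τ M y : ℕ) : Set (ℕ × Fin n → Bool) :=
  {ω | ∃ k < M, ∃ v : Fin n, y < v.1 ∧ v.1 ≤ y + M ∧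
    numOps ω v m (m + τ + k) ≤ numOps ω o (m + τ) (m + τ + k)}

theorem dependsOn_catchUp (o : Fin n) (m τ M y : ℕ) :
    DependsOn (fun ω => ω ∈ catchUp o m τ M y)
      ((Finset.Ico m (m + τ + M) ×ˢ Finset.univ : Finset (ℕ × Fin n)) : Set (ℕ × Fin n)) := by
  intro ω ω' h
  have key : ∀ k < M, ∀ v : Fin n, (numOps ω v m (m + τ + k) ≤ numOps ω o (m + τ) (m + τ + k)) =
      (numOps ω' v m (m + τ + k) ≤ numOps ω' o (m + τ) (m + τ + k)) := by
    intro k hk v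
    refine dependsOn_numOps_le fun i hi => h i ?_
    simp only [Finset.coe_product, Finset.coe_Ico, Finset.coe_univ, Set.mem_prod, Set.mem_Ico,
      Set.mem_univ, and_true] at hi ⊢
    omega
  refine propext (exists_congr fun k => and_congr_right fun hk => exists_congr fun v => ?_)
  rw [key k hk v]

theorem selectionLaw_catchUp_le {o : Fin n} (ho : o.1 = 0) {m τ M : ℕ} (hτ : 0 < τ) (hM : τ ≤ M)
    (y : ℕ) : selectionLaw n p (catchUp o m τ M y) ≤
      ENNReal.ofReal (M ^ 2 * Real.exp (-(2 * (p : ℝ) ^ 2 * τ ^ 2 / (3 * M)))) := by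
  classical
  let V := Finset.univ.filter fun v : Fin n => y < v.1 ∧ v.1 ≤ y + M
  have hV : V.card ≤ M := by
    calc V.card ≤ (Finset.Ioc y (y + M)).card :=
          Finset.card_le_card_of_injOn (fun v : Fin n => v.1)
            (fun v hv => by simpa [V] using hv) fun a _ b _ h => Fin.ext h
      _ = M := by simp
  set e := ENNReal.ofReal (Real.exp (-(2 * (p : ℝ) ^ 2 * τ ^ 2 / (3 * M)))) with he
  have hτ' : (0 : ℝ) < τ := by exact_mod_cast hτ
  calc selectionLaw n p (catchUp o m τ M y)
      ≤ selectionLaw n p (⋃ k ∈ Finset.range M, ⋃ v ∈ V,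
          {ω | numOps ω v m (m + τ + k) ≤ numOps ω o (m + τ) (m + τ + k)}) := by
        refine measure_mono ?_
        rintro ω ⟨k, hk, v, h1, h2, h3⟩
        exact Set.mem_biUnion (x := k) (by simpa using hk)
          (Set.mem_biUnion (x := v) (by simpa [V] using ⟨h1, h2⟩) h3)
    _ ≤ ∑ k ∈ Finset.range M, ∑ v ∈ V, e := by
        refine (measure_biUnion_finset_le _ _).trans (Finset.sum_le_sum fun k hk => ?_)
        refine (measure_biUnion_finset_le _ _).trans (Finset.sum_le_sum fun v hv => ?_)
        have hv0 : v ≠ o := by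
          rintro rfl
          simp only [V, Finset.mem_filter] at hv
          omega
        refine (selectionLaw_numOps_le hv0 m τ k).trans (ENNReal.ofReal_le_ofReal ?_)
        have hk' : (τ : ℝ) + 2 * k ≤ 3 * M := by
          have := Finset.mem_range.1 hk
          exact_mod_cast (by omega : τ + 2 * k ≤ 3 * M)
        gcongr
    _ = ((M * V.card : ℕ) : ENNReal) * e := by
        simp only [Finset.sum_const, Finset.card_range, nsmul_eq_mul]
        push_cast; ring
    _ ≤ ((M ^ 2 : ℕ) : ENNReal) * e := by
        gcongr
        rw [sq]
        exact Nat.mul_le_mul_left M hV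
    _ = _ := by
        rw [he, ENNReal.ofReal_mul (by positivity)]
        congr 1
        rw [← Nat.cast_pow, ENNReal.ofReal_natCast]

/-- The first boundary in `[s, N)` which is given by a record; if there is none, the value `0`
is meaningless. -/
noncomputable def recordBoundary (ω : ℕ × Fin n → Bool) (s N : ℕ) : ℕ :=
  sInf {y | s ≤ y ∧ y < N ∧ ∃ w : Fin n, w.1 = y + 1 ∧ IsRecord ω w}

theorem dependsOn_recordBoundary {o l : Fin n} (ho : o.1 = 0) (hl : l.1 = n - 1) {m : ℕ}
    (s N k : ℕ) :
    DependsOn (fun ω => ω ∈ firstOperationEvent o l m ∩ {ω | recordBoundary ω s N = k})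
      (firstRows n m : Set (ℕ × Fin n)) :=
  dependsOn_of_firstOperation ho hl fun g =>
    sInf {y | s ≤ y ∧ y < N ∧ ∃ w : Fin n, w.1 = y + 1 ∧
      0 < w.1 ∧ ∀ u : Fin n, 0 < u.1 → u ≤ w → g u ≤ g w} = k

theorem recordBoundary_mem {N s : ℕ} (hs : s < N) (hN : N < n)
    (h : ¬ LatestIn (fun v => firstOperation v ω) N 0 s) :
    s ≤ recordBoundary ω s N ∧ recordBoundary ω s N < N ∧
      ∃ w : Fin n, w.1 = recordBoundary ω s N + 1 ∧ IsRecord ω w := by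
  have hne : {y | s ≤ y ∧ y < N ∧ ∃ w : Fin n, w.1 = y + 1 ∧ IsRecord ω w}.Nonempty := by
    obtain ⟨w, h1, h2, h3⟩ := exists_isRecord hs hN h
    have := h3.1
    exact ⟨w.1 - 1, by omega, by omega, w, by omega, h3⟩
  exact Nat.sInf_mem hne

/-- The probability that the root gets rid of all its descendants early. Looking at one record
boundary in each of the windows `[s j, A * s j)`, the delay of the root is at least one per boundary
for the first `D` boundaries, and then follows the sequence `seq`, unless the operations on the
root catch up with those on some vertex, which has probability at most `δ` each time. -/
theorem selectionLaw_not_arrivesAfter_le {o l : Fin n} (ho : o.1 = 0) (hl : l.1 = n - 1)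
    {m A D N : ℕ} {s seq : ℕ → ℕ} {δ : ENNReal} (hm : 1 ≤ m) (hN : 0 < N)
    (hs : ∀ j, s j < A * s j) (hs' : ∀ j, A * s j + N ≤ s (j + 1)) (hn : A * s (2 * D) < n)
    (hseq : ∀ i ≤ D, seq i = i)
    (hδ : ∀ i, D ≤ i → seq i < N → ∀ y,
      selectionLaw n p (catchUp o m (seq i) (min N (seq (i + 1))) y) ≤ δ) :
    selectionLaw n p (firstOperationEvent o l m ∩
        {ω | ¬ ArrivesAfter ω o 0 (m + min N (seq (2 * D)))}) ≤
      ((2 * D + 1 : ℕ) * (A : ENNReal)⁻¹ + D * δ) *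
        selectionLaw n p (firstOperationEvent o l m) := by
  classical
  set E := firstOperationEvent o l m with hE
  set J := 2 * D + 1 with hJ
  let y : ℕ → (ℕ × Fin n → Bool) → ℕ := fun i ω =>
    recordBoundary ω (s (J - 1 - i)) (A * s (J - 1 - i))
  let bad : ℕ → ℕ → Set (ℕ × Fin n → Bool) := fun i k =>
    if seq i < N then catchUp o m (seq i) (min N (seq (i + 1))) k else ∅
  have hA : 0 < A := by
    rcases Nat.eq_zero_or_pos A with rfl | h
    · have := hs 0; omega
    · exact h
  have hsmono : ∀ j, j ≤ 2 * D → A * s j < n := by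
    have hmono : Monotone s := monotone_nat_of_le_succ fun j => by
      have := hs j; have := hs' j; omega
    intro j hj
    exact (Nat.mul_le_mul_left A (hmono hj)).trans_lt hn
  have hcover : E ∩ {ω | ¬ ArrivesAfter ω o 0 (m + min N (seq (2 * D)))} ⊆
      (⋃ j ∈ Finset.range J, E ∩ {ω | LatestIn (fun v => firstOperation v ω) (A * s j) 0 (s j)}) ∪
      ⋃ i ∈ Finset.Ico D (2 * D), E ∩ {ω | ω ∈ bad i (y (i + 1) ω)} := by
    rintro ω ⟨hω, hna⟩
    by_contra hcon
    simp only [Set.mem_union, Set.mem_iUnion, not_or, not_exists, Set.mem_inter_iff, not_and,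
      Finset.mem_range, Finset.mem_Ico, Set.mem_ofPred_eq] at hcon
    obtain ⟨hL, hB⟩ := hcon
    have hrec : ∀ i < J, s (J - 1 - i) ≤ y i ω ∧ y i ω < A * s (J - 1 - i) ∧
        ∃ w : Fin n, w.1 = y i ω + 1 ∧ IsRecord ω w := fun i hi =>
      recordBoundary_mem (hs _) (hsmono _ (by omega)) (hL _ (by omega) hω)
    refine hna ((ArrivesAfter.chain (J := J) (y := fun i => y i ω) (seq := seq) ho hm hN ?_ ?_ ?_
      (hseq 0 (by omega)) ?_ (2 * D) (by omega)).mono (Nat.zero_le _) le_rfl)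
    · obtain ⟨-, -, w, hw, -⟩ := hrec 0 (by omega)
      exact firstOperationEvent.arrivesAfter hω (by omega)
    · intro i hi
      obtain ⟨-, -, w, hw, hw'⟩ := hrec i hi
      have := hw'.isBoundary ho hl hω
      rwa [hw, Nat.add_sub_cancel] at this
    · intro i hi
      have h1 := (hrec (i + 1) hi).2.1
      have h2 := (hrec i (by omega)).1
      have h3 := hs' (J - 1 - (i + 1))
      rw [show J - 1 - (i + 1) + 1 = J - 1 - i by omega] at h3
      omega
    · intro i hi
      by_cases hiD : i < D
      · left; rw [hseq i hiD.le, hseq (i + 1) hiD]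
      · right
        intro hlt k hk v hv1 hv2
        by_contra hops
        refine hB i ⟨by omega, by omega⟩ hω ?_
        simp only [bad, if_pos hlt]
        exact ⟨k, hk, v, hv1, hv2, not_lt.1 hops⟩
  refine (measure_mono hcover).trans ((measure_union_le _ _).trans ?_)
  rw [add_mul]
  refine add_le_add ?_ ?_
  · refine (measure_biUnion_finset_le _ _).trans ?_
    calc ∑ j ∈ Finset.range J, selectionLaw n p
          (E ∩ {ω | LatestIn (fun v => firstOperation v ω) (A * s j) 0 (s j)})
        ≤ ∑ _j ∈ Finset.range J, (A : ENNReal)⁻¹ * selectionLaw n p E :=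
          Finset.sum_le_sum fun j hj => selectionLaw_latestIn_le ho hl hA
            (hsmono j (by have := Finset.mem_range.1 hj; omega))
      _ = _ := by simp [mul_assoc]
  · refine (measure_biUnion_finset_le _ _).trans ?_
    calc ∑ i ∈ Finset.Ico D (2 * D), selectionLaw n p (E ∩ {ω | ω ∈ bad i (y (i + 1) ω)})
        ≤ ∑ _i ∈ Finset.Ico D (2 * D), δ * selectionLaw n p E := by
          refine Finset.sum_le_sum fun i hi => ?_
          rw [Finset.mem_Ico] at hi
          by_cases hlt : seq i < N
          · refine selectionLaw_inter_random_le (Y := y (i + 1)) (I := firstRows n m)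
              (J := Finset.Ico m (m + seq i + min N (seq (i + 1))) ×ˢ Finset.univ)
              (fun k => dependsOn_recordBoundary ho hl _ _ k) (fun k => ?_) ?_ (fun k => ?_)
            · simp only [bad, if_pos hlt]
              exact dependsOn_catchUp o m _ _ k
            · rw [Finset.disjoint_left]
              intro x h1 h2
              simp only [firstRows, Finset.mem_product, Finset.mem_range, Finset.mem_Ico] at h1 h2
              omega
            · simp only [bad, if_pos hlt]
              exact hδ i hi.1 hlt k
          · simp [bad, if_neg hlt]
      _ = _ := by
        rw [Finset.sum_const, Nat.card_Ico, nsmul_eq_mul, show 2 * D - D = D by omega, mul_assoc]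

end Chain

/-! ### Choice of the parameters -/

section Parameters

/-- Lower bounds for the delay of the root at successive boundaries: it is at least `i` at the
`i`-th boundary for `i ≤ D`, and from then on a delay `τ` grows to about `τ ^ (3 / 2)`. -/
def delaySeq (D : ℕ) : ℕ → ℕ
  | 0 => 0
  | i + 1 => if i < D then i + 1 else delaySeq D i * Nat.sqrt (delaySeq D i)

theorem delaySeq_of_le {D i : ℕ} (h : i ≤ D) : delaySeq D i = i := by
  cases i with
  | zero => rfl
  | succ i => exact if_pos h

theorem delaySeq_succ_of_le {D i : ℕ} (h : D ≤ i) :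
    delaySeq D (i + 1) = delaySeq D i * Nat.sqrt (delaySeq D i) :=
  if_neg (not_lt.2 h)

theorem le_sqrt_pow_four {t : ℕ} (ht : 4 ≤ t) : t ≤ Nat.sqrt t ^ 4 := by
  have h1 : t < (Nat.sqrt t + 1) ^ 2 := Nat.lt_succ_sqrt' t
  have h2 : 2 ≤ Nat.sqrt t := Nat.le_sqrt.2 ht
  have h3 : Nat.sqrt t + 1 ≤ Nat.sqrt t ^ 2 := by nlinarith
  calc t ≤ (Nat.sqrt t + 1) ^ 2 := h1.le
    _ ≤ (Nat.sqrt t ^ 2) ^ 2 := Nat.pow_le_pow_left h3 2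
    _ = Nat.sqrt t ^ 4 := by ring

theorem le_delaySeq {D i : ℕ} (hD : 4 ≤ D) (h : D ≤ i) : D ≤ delaySeq D i := by
  induction i, h using Nat.le_induction with
  | base => rw [delaySeq_of_le le_rfl]
  | succ i hi ih =>
    rw [delaySeq_succ_of_le hi]
    exact ih.trans (Nat.le_mul_of_pos_right _ (Nat.sqrt_pos.2 (by omega)))

theorem pow_mul_log_le_log_delaySeq {D : ℕ} (hD : 4 ≤ D) (i : ℕ) :
    (5 / 4 : ℝ) ^ i * Real.log D ≤ Real.log (delaySeq D (D + i)) := by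
  induction i with
  | zero => simp [delaySeq_of_le]
  | succ i ih =>
    have ht := le_delaySeq hD (Nat.le_add_right D i)
    rw [← add_assoc, delaySeq_succ_of_le (by omega)]
    set t := delaySeq D (D + i) with ht'
    have hs : 0 < Nat.sqrt t := Nat.sqrt_pos.2 (by omega)
    have h1 : Real.log t ≤ 4 * Real.log (Nat.sqrt t) := by
      rw [show (4 : ℝ) = (4 : ℕ) by norm_num, ← Real.log_pow]
      refine Real.log_le_log (by exact_mod_cast (by omega : 0 < t)) ?_
      exact_mod_cast le_sqrt_pow_four (by omega)
    rw [Nat.cast_mul, Real.log_mul (by exact_mod_cast (by omega : t ≠ 0))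
      (by exact_mod_cast hs.ne'), pow_succ]
    nlinarith

theorem le_delaySeq_two_mul {D n : ℕ} (hD : 4 ≤ D) (hn : 16 ≤ n)
    (h : 5 * Real.log (Real.log n) ≤ D) : n ≤ delaySeq D (2 * D) := by
  have hlog : 0 < Real.log n := Real.log_pos (by exact_mod_cast (by omega : 1 < n))
  have h54 : (1 / 5 : ℝ) ≤ Real.log (5 / 4) := by
    have := Real.one_sub_inv_le_log_of_pos (x := 5 / 4) (by norm_num)
    norm_num at this ⊢
    exact this
  have h1 : Real.log n ≤ (5 / 4 : ℝ) ^ D := by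
    rw [← Real.log_le_log_iff hlog (by positivity), Real.log_pow]
    nlinarith
  have h2 : 1 ≤ Real.log D := by
    rw [Real.le_log_iff_exp_le (by exact_mod_cast (by omega : 0 < D))]
    have : (4 : ℝ) ≤ D := by exact_mod_cast hD
    linarith [Real.exp_one_lt_d9]
  have h3 := pow_mul_log_le_log_delaySeq hD D
  have h4 : Real.log n ≤ Real.log (delaySeq D (D + D)) :=
    h1.trans ((le_mul_of_one_le_right (by positivity) h2).trans h3)
  have h5 := le_delaySeq hD (Nat.le_add_right D D)
  rw [Real.log_le_log_iff (by exact_mod_cast (by omega : 0 < n))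
    (by exact_mod_cast (by omega : 0 < delaySeq D (D + D)))] at h4
  rw [two_mul]
  exact_mod_cast h4

/-- The probability of a catch-up is at most `1 / (4 D)` once the delay `τ ≥ D` is at least a
constant times `p ^ (-36)`. -/
theorem catchUp_bound_le {p : ℝ} (hp : 0 < p) {D τ M : ℕ} (hD : 0 < D) (hDτ : D ≤ τ) (hM : τ ≤ M)
    (hM' : M ≤ τ * Nat.sqrt τ) (hτ : (4 * 14 ^ 9) ^ 2 / p ^ 36 ≤ (D : ℝ)) :
    (M : ℝ) ^ 2 * Real.exp (-(2 * p ^ 2 * τ ^ 2 / (3 * M))) ≤ 1 / (4 * D) := by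
  have hD0 : (0 : ℝ) < D := by exact_mod_cast hD
  have hDτ' : (D : ℝ) ≤ τ := by exact_mod_cast hDτ
  have hτ0 : (0 : ℝ) < τ := hD0.trans_le hDτ'
  set r := Real.sqrt τ with hr
  have hr0 : 0 < r := Real.sqrt_pos.2 hτ0
  have hr2 : (τ : ℝ) = r ^ 2 := (Real.sq_sqrt hτ0.le).symm
  have hM0 : (0 : ℝ) < M := by exact_mod_cast (by omega : 0 < M)
  have hMr : (M : ℝ) ≤ r ^ 3 := by
    calc (M : ℝ) ≤ τ * Nat.sqrt τ := by exact_mod_cast hM'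
      _ ≤ τ * r := by gcongr; exact Real.nat_sqrt_le_real_sqrt
      _ = r ^ 3 := by rw [hr2]; ring
  have hrp : 4 * 14 ^ 9 / p ^ 18 ≤ r := by
    refine Real.le_sqrt_of_sq_le ?_
    calc ((4 * 14 ^ 9 / p ^ 18 : ℝ)) ^ (2 : ℕ) = (4 * 14 ^ 9) ^ 2 / p ^ 36 := by
          rw [div_pow, ← pow_mul]
      _ ≤ (τ : ℝ) := hτ.trans hDτ'
  have hexp : 4 * r ^ 8 ≤ Real.exp (2 / 3 * p ^ 2 * r) := by
    have h1 : (p ^ 2 * r / 14) ^ 9 ≤ Real.exp (2 / 3 * p ^ 2 * r) := by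
      calc (p ^ 2 * r / 14) ^ 9 ≤ Real.exp (p ^ 2 * r / 14) ^ 9 := by
            gcongr
            linarith [Real.add_one_le_exp (p ^ 2 * r / 14)]
        _ = Real.exp (9 * (p ^ 2 * r / 14)) := by rw [← Real.exp_nat_mul]; norm_num
        _ ≤ Real.exp (2 / 3 * p ^ 2 * r) := by
            refine Real.exp_le_exp.2 ?_
            have : 0 < p ^ 2 * r := by positivity
            linarith
    refine le_trans ?_ h1
    rw [div_le_iff₀ (by positivity)] at hrp
    calc 4 * r ^ 8 = (4 * 14 ^ 9) * (r ^ 8 / 14 ^ 9) := by field_simp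
      _ ≤ (r * p ^ 18) * (r ^ 8 / 14 ^ 9) := by gcongr
      _ = (p ^ 2 * r / 14) ^ 9 := by ring
  have hexp' : Real.exp (-(2 * p ^ 2 * τ ^ 2 / (3 * M))) ≤ Real.exp (-(2 / 3 * p ^ 2 * r)) := by
    refine Real.exp_le_exp.2 (neg_le_neg ?_)
    rw [le_div_iff₀ (by positivity), hr2]
    calc 2 / 3 * p ^ 2 * r * (3 * M) ≤ 2 / 3 * p ^ 2 * r * (3 * r ^ 3) := by gcongr
      _ = 2 * p ^ 2 * (r ^ 2) ^ 2 := by ring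
  calc (M : ℝ) ^ 2 * Real.exp (-(2 * p ^ 2 * τ ^ 2 / (3 * M)))
      ≤ (r ^ 3) ^ 2 * Real.exp (-(2 / 3 * p ^ 2 * r)) := by gcongr
    _ = r ^ 6 / Real.exp (2 / 3 * p ^ 2 * r) := by rw [Real.exp_neg]; ring
    _ ≤ r ^ 6 / (4 * r ^ 8) := by gcongr
    _ = 1 / (4 * τ) := by rw [hr2]; field_simp
    _ ≤ 1 / (4 * D) := by gcongr

theorem one_le_log_log {n : ℕ} (hn : 16 ≤ n) : 1 ≤ Real.log (Real.log n) := by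
  have h16 : Real.log 16 = 4 * Real.log 2 := by
    rw [show (16 : ℝ) = 2 ^ 4 by norm_num, Real.log_pow]; norm_num
  have h1 : Real.log 16 ≤ Real.log n :=
    Real.log_le_log (by norm_num) (by exact_mod_cast hn)
  have h2 : Real.exp 1 ≤ Real.log n := by
    linarith [Real.exp_one_lt_d9, Real.log_two_gt_d9]
  rwa [Real.le_log_iff_exp_le ((Real.exp_pos 1).trans_le h2)]

/-- A number of windows which is large enough for the delay to reach `N ≥ f(n)`, and small enough
for the windows to fit into `[1, n)`. -/
theorem exists_parameters {B p : ℝ} (hB : 5 ≤ B) (hp0 : 0 < p) (hp1 : p < 1) {n : ℕ} (hn : 16 ≤ n)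
    {f : ℝ} (hf : f = n * Real.exp (-(p ^ 8 * Real.exp ((40 + 292 * B ^ 2) / p ^ 2) *
      Real.log (Real.log n) ^ 4))) (hf1 : 1 < f) :
    ∃ D N : ℕ, 4 ≤ D ∧ B / p ^ 36 ≤ D ∧ 5 * Real.log (Real.log n) ≤ D ∧ 0 < N ∧ f ≤ N ∧ N ≤ n ∧
      (8 * (2 * D + 1)) ^ (2 * D + 1) * N < n := by
  have hL := one_le_log_log hn
  set L := Real.log (Real.log n) with hLdef
  set K := p ^ 8 * Real.exp ((40 + 292 * B ^ 2) / p ^ 2) with hK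
  have hn0 : (0 : ℝ) < n := by exact_mod_cast (by omega : 0 < n)
  have hp36 : p ^ 36 ≤ 1 := pow_le_one₀ hp0.le hp1.le
  have hp2 : p ^ 2 ≤ 1 := pow_le_one₀ hp0.le hp1.le
  have hBL : B * L ≤ B * L / p ^ 36 := le_div_self (by positivity) (by positivity) hp36
  have hD := Nat.le_ceil (B * L / p ^ 36)
  have hD' := Nat.ceil_lt_add_one (a := B * L / p ^ 36) (by positivity)
  set D := ⌈B * L / p ^ 36⌉₊ with hDdef
  have hD5 : 5 * L ≤ D := by nlinarith
  have hD4 : (4 : ℝ) ≤ D := by linarith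
  have hKB : 292 * B ^ 2 / p ^ 72 ≤ K := by
    have h1 : (1 / p ^ 2) ^ 40 * (292 * B ^ 2) ≤ Real.exp ((40 + 292 * B ^ 2) / p ^ 2) := by
      have h2 : 292 * B ^ 2 ≤ Real.exp (292 * B ^ 2 / p ^ 2) := by
        have h3 : 292 * B ^ 2 ≤ 292 * B ^ 2 / p ^ 2 :=
          le_div_self (by positivity) (by positivity) hp2
        linarith [Real.add_one_le_exp (292 * B ^ 2 / p ^ 2)]
      calc (1 / p ^ 2) ^ 40 * (292 * B ^ 2)
          ≤ Real.exp (1 / p ^ 2) ^ 40 * Real.exp (292 * B ^ 2 / p ^ 2) := by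
            gcongr
            linarith [Real.add_one_le_exp (1 / p ^ 2)]
        _ = Real.exp ((40 + 292 * B ^ 2) / p ^ 2) := by
            rw [← Real.exp_nat_mul, ← Real.exp_add]
            congr 1
            push_cast
            ring
    calc 292 * B ^ 2 / p ^ 72 = p ^ 8 * ((1 / p ^ 2) ^ 40 * (292 * B ^ 2)) := by
          field_simp
      _ ≤ K := by rw [hK]; gcongr
  have hG : 73 * (D : ℝ) ^ 2 ≤ K * L ^ 4 := by
    have h1 : (D : ℝ) ≤ 2 * (B * L / p ^ 36) := by nlinarith
    calc 73 * (D : ℝ) ^ 2 ≤ 73 * (2 * (B * L / p ^ 36)) ^ 2 := by gcongr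
      _ = (292 * B ^ 2 / p ^ 72) * L ^ 2 := by field_simp; ring
      _ ≤ K * L ^ 2 := by gcongr
      _ ≤ K * L ^ 4 := by
        have : 0 ≤ K := by positivity
        gcongr
        · norm_num
  have hfn : f ≤ n := by
    rw [hf]
    refine mul_le_of_le_one_right hn0.le (Real.exp_le_one_iff.2 ?_)
    have : 0 ≤ K * L ^ 4 := by positivity
    linarith
  have hN' := Nat.ceil_lt_add_one (a := f) (by linarith)
  refine ⟨D, ⌈f⌉₊, by exact_mod_cast hD4, ?_, hD5, Nat.ceil_pos.2 (by linarith), Nat.le_ceil f,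
    Nat.ceil_le.2 hfn, ?_⟩
  · refine le_trans ?_ hD
    gcongr
    nlinarith
  have hx : (8 * (2 * D + 1) : ℝ) ^ (2 * D + 1) ≤ Real.exp (72 * D ^ 2) := by
    calc (8 * (2 * D + 1) : ℝ) ^ (2 * D + 1) ≤ Real.exp (8 * (2 * D + 1)) ^ (2 * D + 1) := by
          gcongr
          linarith [Real.add_one_le_exp (8 * (2 * (D : ℝ) + 1))]
      _ = Real.exp ((2 * D + 1) * (8 * (2 * D + 1))) := by
          rw [← Real.exp_nat_mul]; push_cast; rfl
      _ ≤ Real.exp (72 * D ^ 2) := Real.exp_le_exp.2 (by nlinarith)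
  have h2 : (2 : ℝ) ≤ Real.exp (D ^ 2) := by
    nlinarith [Real.add_one_le_exp ((D : ℝ) ^ 2)]
  have : ((8 * (2 * D + 1)) ^ (2 * D + 1) : ℝ) * (⌈f⌉₊ : ℝ) < n := by
    calc ((8 * (2 * D + 1)) ^ (2 * D + 1) : ℝ) * (⌈f⌉₊ : ℝ)
        < (8 * (2 * D + 1)) ^ (2 * D + 1) * (2 * f) := by
          have : (⌈f⌉₊ : ℝ) < 2 * f := by linarith
          gcongr
      _ ≤ Real.exp (72 * D ^ 2) * (Real.exp (D ^ 2) * f) := by gcongr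
      _ = n * Real.exp (73 * D ^ 2 - K * L ^ 4) := by
          rw [hf, sub_eq_add_neg, Real.exp_add, show (73 : ℝ) * D ^ 2 = 72 * D ^ 2 + D ^ 2 by ring,
            Real.exp_add]
          ring
      _ ≤ n := mul_le_of_le_one_right hn0.le (Real.exp_le_one_iff.2 (by linarith))
  exact_mod_cast this

end Parameters

/-! ### The lower bound -/

theorem selectionLaw_not_arrivesAfter_le_half {n : ℕ} {p : unitInterval} (hp0 : 0 < p)
    {o l : Fin n} (ho : o.1 = 0) (hl : l.1 = n - 1) {m D N : ℕ} (hm : 1 ≤ m) (hD : 4 ≤ D)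
    (hDp : (4 * 14 ^ 9) ^ 2 / (p : ℝ) ^ 36 ≤ D) (hN : 0 < N) (hND : N ≤ delaySeq D (2 * D))
    (hn : (8 * (2 * D + 1)) ^ (2 * D + 1) * N < n) :
    selectionLaw n p (firstOperationEvent o l m ∩ {ω | ¬ ArrivesAfter ω o 0 (m + N)}) ≤
      2⁻¹ * selectionLaw n p (firstOperationEvent o l m) := by
  have hp0' : (0 : ℝ) < p := hp0
  set A := 4 * (2 * D + 1) with hA
  have hA2 : 8 * (2 * D + 1) = 2 * A := by omega
  rw [hA2] at hn
  let s : ℕ → ℕ := fun j => (2 * A) ^ j * N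
  have hsN : ∀ j, N ≤ s j := fun j => Nat.le_mul_of_pos_left N (by positivity)
  have h := selectionLaw_not_arrivesAfter_le (p := p) ho hl (m := m) (A := A) (D := D) (N := N)
    (s := s) (seq := delaySeq D) (δ := ENNReal.ofReal (1 / (4 * D))) hm hN
    (fun j => by have := hsN j; nlinarith)
    (fun j => by
      have := hsN j
      have e : s (j + 1) = 2 * A * s j := by simp only [s]; ring
      rw [e]; nlinarith)
    (by
      refine lt_of_le_of_lt ?_ hn
      simp only [s]
      rw [pow_succ]
      nlinarith [Nat.zero_le ((2 * A) ^ (2 * D) * N * A)])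
    (fun i hi => delaySeq_of_le hi)
    (fun i hi hlt y => by
      have hDi := le_delaySeq hD hi
      have hsq : 0 < Nat.sqrt (delaySeq D i) := Nat.sqrt_pos.2 (by omega)
      have hle : delaySeq D i ≤ min N (delaySeq D (i + 1)) := by
        rw [delaySeq_succ_of_le hi]
        exact le_min hlt.le (Nat.le_mul_of_pos_right _ hsq)
      refine (selectionLaw_catchUp_le ho (by omega) hle y).trans (ENNReal.ofReal_le_ofReal ?_)
      refine catchUp_bound_le hp0' (by omega) hDi hle ?_ hDp
      rw [← delaySeq_succ_of_le hi]
      exact min_le_right _ _)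
  rw [min_eq_left hND] at h
  refine h.trans ?_
  gcongr
  have hD0 : (0 : ℝ) < D := by exact_mod_cast (by omega : 0 < D)
  have e1 : ((2 * D + 1 : ℕ) : ENNReal) * (A : ENNReal)⁻¹ = ENNReal.ofReal (1 / 4) := by
    rw [← div_eq_mul_inv, ← ENNReal.ofReal_natCast, ← ENNReal.ofReal_natCast,
      ← ENNReal.ofReal_div_of_pos (by rw [hA]; positivity)]
    congr 1
    rw [hA]
    push_cast
    field_simp
  have e2 : (D : ENNReal) * ENNReal.ofReal (1 / (4 * D)) = ENNReal.ofReal (1 / 4) := by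
    rw [← ENNReal.ofReal_natCast, ← ENNReal.ofReal_mul hD0.le]
    congr 1
    field_simp
  rw [e1, e2, ← ENNReal.ofReal_add (by norm_num) (by norm_num)]
  have : (2⁻¹ : ENNReal) = ENNReal.ofReal (1 / 2) := by
    rw [one_div, ENNReal.ofReal_inv_of_pos (by norm_num)]; norm_num
  rw [this]
  exact ENNReal.ofReal_le_ofReal (by norm_num)

theorem ArrivesAfter.le_isolationTime {n : ℕ} {ω : ℕ × Fin n → Bool} {o : Fin n} (ho : o.1 = 0)
    {σ : ℕ} (h : ArrivesAfter ω o 0 σ) : (σ : ℕ∞) ≤ isolationTime o ω := by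
  refine le_iInf₂ fun t ht => ?_
  rw [Nat.cast_le]
  exact h t (OrderedForest.IsIsolated.lastDesc_eq_zero ho ht).le

theorem half_le_cond_of_arrivesAfter {n : ℕ} {p : unitInterval} (hp0 : 0 < p) (hp1 : p < 1)
    {o l : Fin n} (ho : o.1 = 0) (hl : l.1 = n - 1) {m N : ℕ} (hm : 2 ≤ m)
    (h : selectionLaw n p (firstOperationEvent o l m ∩ {ω | ¬ ArrivesAfter ω o 0 (m + N)}) ≤
      2⁻¹ * selectionLaw n p (firstOperationEvent o l m))
    {f : ℝ} (hf : f ≤ N + 1) :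
    1 / 2 ≤ ProbabilityTheory.cond (selectionLaw n p) (firstOperationEvent o l m)
      {ω | ENNReal.ofReal (f + m - 1) ≤ ((isolationTime o ω : ℕ∞) : ENNReal)} := by
  set E := firstOperationEvent o l m with hE
  set S := {ω : ℕ × Fin n → Bool | ENNReal.ofReal (f + m - 1) ≤
    ((isolationTime o ω : ℕ∞) : ENNReal)} with hS
  have hsub : ∀ ω, ArrivesAfter ω o 0 (m + N) → ω ∈ S := by
    intro ω hω
    calc ENNReal.ofReal (f + m - 1) ≤ ENNReal.ofReal ((m + N : ℕ) : ℝ) :=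
          ENNReal.ofReal_le_ofReal (by push_cast; linarith)
      _ = (((m + N : ℕ) : ℕ∞) : ENNReal) := by rw [ENNReal.ofReal_natCast]; simp
      _ ≤ _ := ENat.toENNReal_le.2 (hω.le_isolationTime ho)
  have hE0 := selectionLaw_firstOperationEvent_ne_zero o l hm hp0 hp1
  have hEtop : selectionLaw n p E ≠ ⊤ := measure_ne_top _ _
  have hle : selectionLaw n p E ≤ selectionLaw n p (E ∩ S) + 2⁻¹ * selectionLaw n p E := by
    refine (measure_mono fun ω hω => ?_).trans ((measure_union_le (E ∩ S)
      (E ∩ {ω | ¬ ArrivesAfter ω o 0 (m + N)})).trans (by gcongr))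
    by_cases h' : ArrivesAfter ω o 0 (m + N)
    · exact Or.inl ⟨hω, hsub ω h'⟩
    · exact Or.inr ⟨hω, h'⟩
  have hhalf : 2⁻¹ * selectionLaw n p E ≤ selectionLaw n p (E ∩ S) := by
    have e : selectionLaw n p E = 2⁻¹ * selectionLaw n p E + 2⁻¹ * selectionLaw n p E := by
      rw [← add_mul, ENNReal.inv_two_add_inv_two, one_mul]
    have htop : 2⁻¹ * selectionLaw n p E ≠ ⊤ := ENNReal.mul_ne_top (by simp) hEtop
    exact (ENNReal.add_le_add_iff_right htop).1 (e.symm.le.trans hle)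
  rw [cond_apply (measurableSet_of_dependsOn (dependsOn_firstOperationEvent ho hl)), one_div,
    ← ENNReal.div_eq_inv_mul, ENNReal.le_div_iff_mul_le (Or.inl hE0) (Or.inl hEtop)]
  exact hhalf

theorem mainTheorem3 :
    ∃ C : ℝ, 4 < C ∧ ∀ p : unitInterval, 0 < p → p < 1 →
      ∀ (n m : ℕ) (hn : 2 ≤ n), 2 ≤ m →
        1 / 2 ≤ ProbabilityTheory.cond (selectionLaw n p)
          (firstOperationEvent (⟨0, by omega⟩ : Fin n) ⟨n - 1, by omega⟩ m)
          {ω | ENNReal.ofReal (lowerRate C p n + m - 1) ≤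
            ((isolationTime (⟨0, by omega⟩ : Fin n) ω : ℕ∞) : ENNReal)} := by
  refine ⟨40 + 292 * ((4 * 14 ^ 9) ^ 2) ^ 2, by norm_num, fun p hp0 hp1 n m hn hm => ?_⟩
  by_cases hf : lowerRate (40 + 292 * ((4 * 14 ^ 9) ^ 2) ^ 2) p n ≤ 1
  · refine half_le_cond_of_arrivesAfter hp0 hp1 rfl rfl hm (N := 0) ?_ (by simpa using hf)
    rw [show firstOperationEvent (⟨0, by omega⟩ : Fin n) ⟨n - 1, by omega⟩ m ∩
      {ω | ¬ ArrivesAfter ω (⟨0, by omega⟩ : Fin n) 0 (m + 0)} = ∅ from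
        Set.eq_empty_of_forall_notMem fun ω hω =>
          hω.2 (firstOperationEvent.arrivesAfter hω.1 (by omega))]
    simp
  · have h16 : (16 : ℝ) ≤ n := by
      by_contra h
      exact hf (by rw [lowerRate, if_neg h])
    rw [lowerRate, if_pos h16, max_le_iff, not_and] at hf
    have hf1 := not_le.1 (hf le_rfl)
    obtain ⟨D, N, hD4, hDp, hDL, hN, hfN, hNn, hlt⟩ := exists_parameters (by norm_num) hp0 hp1
      (by exact_mod_cast h16) rfl hf1
    refine half_le_cond_of_arrivesAfter hp0 hp1 rfl rfl hm
      (selectionLaw_not_arrivesAfter_le_half hp0 rfl rfl (by omega) hD4 hDp hN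
        (hNn.trans (le_delaySeq_two_mul hD4 (by exact_mod_cast h16) hDL)) hlt) ?_
    rw [lowerRate, if_pos h16]
    exact max_le (by linarith [(Nat.cast_nonneg N : (0 : ℝ) ≤ N)]) (by linarith)
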